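/- Let $k\in\{1,2\}$, $a>0$, $c>0$ and $\sigma\le\mu<0$, and put $M_0=-\frac ac$, $N_0=\frac{a\sigma}{c\mu}$. For real $v,x,y$ put $$D(x,y)=(|\mu|+|\sigma|)\bigl[1+(|\mu|+|\sigma|)\max(|x|,|y|)\,c\bigr]\max(|x|,|y|)$$ and define, for $\theta\le 0$, with $\operatorname{sign}(0)=0$, $$H_{(1)}(v,x,y)(\theta)=\begin{cases}x,&\theta<0,\\-\frac{\mu}{\sigma}v,&\theta=0,\end{cases}\qquad H_{(2)}(v,x,y)(\theta)=\begin{cases}x,&\theta\le \operatorname{sign}(y-x)\frac{x+\mu v/\sigma}{D(x,y)},\\-\frac{\mu}{\sigma}v+\operatorname{sign}(y-x)D(x,y)\,\theta,&\theta>\operatorname{sign}(y-x)\frac{x+\mu v/\sigma}{D(x,y)},\end{cases}$$ $$\mathcal Q_{(k)}(v,x,y)=v+\frac{\mu}{\sigma}v\,e^{\mu(a+cv)}-\sigma\int_{-a-cv}^{0}e^{-\mu\theta}H_{(k)}(v,x,y)(\theta)\,d\theta .$$ Let $\mathcal M_{(k)}(x,y)$ denote the point $m\in[M_0,0]$ such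 that $\mathcal Q_{(k)}(v,x,y)$ is negative for $v\in[M_0,m)$, zero for $v=m$ and positive for $v\in(m,0]$. Let $\mathcal N_{(k)}(x,y)$ denote the point $p\ge 0$ such that $\mathcal Q_{(k)}(v,x,y)$ is negative for $v\in[0,p)$, zero for $v=p$ and positive for $v>p$. (Each is unique when it exists.) Define $M_{k,0}=M_0$, $N_{k,0}=N_0$ and recursively $$M_{k,n+1}=\mathcal M_{(k)}(N_{k,n},M_{k,n}),\qquad N_{k,n+1}=\mathcal N_{(k)}(M_{k,n},N_{k,n}).$$ Then: (1) These sequences are well defined, that is, at every step the required points exist, and $M_{k,n}<M_{k,n+1}<0<N_{k,n+1}<N_{k,n}$ for all $n\ge0$; so the intervals $[M_{k,n},N_{k,n}]$ are nested and shrinking. (2) Let $\varphi$ be a history with $N=\max\{\varphi(0),N_0\}$ and $\tau=a+cN$, such that $\varphi$ is continuous on $[-\tau,0]$ and $\varphi(t)\ge M_0$ there. Let $u$ be a solution on $[-\tau,\infty)$ of the sawtooth equation $$\dot u(t)=\mu u(t)+\sigma u\bigl(t-a-cu(t)\bigr)\quad(t>0),\qquad u(t)=\varphi(t)\quad(-\tau\le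 t\le 0),$$ meaning that $u$ is continuous on $[-\tau,\infty)$ and that, for every $t>0$, $t-a-cu(t)\ge-\tau$ (so that the right-hand side is defined), $u$ is differentiable at $t$ and the equation holds. Then there is a sequence of times $T_{k,n}\to\infty$ (as $n\to\infty$) such that $u(t)\in[M_{k,n},N_{k,n}]$ for all $n\ge0$ and all $t\ge T_{k,n}$. In particular, every limit point of $u(t)$ as $t\to\infty$ lies in $\bigcap_n[M_{k,n},N_{k,n}]$. -/

import Mathlib

namespace Sawtooth

noncomputable section

/-- The a priori lower bound `M₀ = -a/c`. -/
def M₀ (a c : ℝ) : ℝ := -a / c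

/-- The a priori upper bound `N₀ = aσ/(cμ)`. -/
def N₀ (a c μ σ : ℝ) : ℝ := a * σ / (c * μ)

/-- For a history `φ`, the upper bound `N = max {φ(0), N₀}`. -/
def upperN (a c μ σ : ℝ) (φ : ℝ → ℝ) : ℝ := max (φ 0) (N₀ a c μ σ)

/-- For a history `φ`, the maximal delay `τ = a + cN`, where `N = max {φ(0), N₀}`. -/
def delayBound (a c μ σ : ℝ) (φ : ℝ → ℝ) : ℝ := a + c * upperN a c μ σ φ

/-- `u` solves `u'(t) = μ u(t) + σ u(t - a - c u(t))` for `t > 0` with `u = φ` on `[-τ, 0]`.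
A solution is a function on `[-τ, ∞)`; its values at points below `-τ` are irrelevant, which is why
the deviating argument is required to lie in `[-τ, ∞)`. -/
structure IsSolution (a c μ σ τ : ℝ) (φ u : ℝ → ℝ) : Prop where
  history : ∀ t ∈ Set.Icc (-τ) 0, u t = φ t
  continuousOn : ContinuousOn u (Set.Ici 0)
  mem_domain : ∀ t > 0, -τ ≤ t - a - c * u t
  hasDerivAt : ∀ t > 0, HasDerivAt u (μ * u t + σ * u (t - a - c * u t)) t

/-- `D(x,y) = (|μ|+|σ|) [1 + (|μ|+|σ|) max(|x|,|y|) c] max(|x|,|y|)`. -/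
def D (c μ σ x y : ℝ) : ℝ :=
  (|μ| + |σ|) * (1 + (|μ| + |σ|) * max |x| |y| * c) * max |x| |y|

/-- `H₍₁₎(v,x,y)(θ)`, for `θ ≤ 0`. -/
def H₁ (μ σ v x θ : ℝ) : ℝ := if θ < 0 then x else -(μ / σ) * v

/-- `H₍₂₎(v,x,y)(θ)`, for `θ ≤ 0`. -/
def H₂ (c μ σ v x y θ : ℝ) : ℝ :=
  if θ ≤ Real.sign (y - x) * ((x + μ * v / σ) / D c μ σ x y) then x
  else -(μ / σ) * v + Real.sign (y - x) * D c μ σ x y * θ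

/-- `H₍ₖ₎(v,x,y)(θ)`; only `k = 1` and `k = 2` are used. -/
def H (c μ σ : ℝ) (k : ℕ) (v x y θ : ℝ) : ℝ :=
  if k = 1 then H₁ μ σ v x θ else H₂ c μ σ v x y θ

/-- `Q₍ₖ₎(v,x,y) = v + (μ/σ) v e^{μ(a+cv)} - σ ∫_{-a-cv}^0 e^{-μθ} H₍ₖ₎(v,x,y)(θ) dθ`. -/
def Q (a c μ σ : ℝ) (k : ℕ) (v x y : ℝ) : ℝ :=
  v + μ / σ * v * Real.exp (μ * (a + c * v))
    - σ * ∫ θ in (-a - c * v)..0, Real.exp (-μ * θ) * H c μ σ k v x y θ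

/-- `m` is the zero of `v ↦ Q₍ₖ₎(v,x,y)` on `[M₀, 0]`: this function is negative on `[M₀, m)`,
vanishes at `m` and is positive on `(m, 0]`. Such an `m` is unique. -/
structure IsLowerZero (a c μ σ : ℝ) (k : ℕ) (x y m : ℝ) : Prop where
  mem : m ∈ Set.Icc (M₀ a c) 0
  neg : ∀ v ∈ Set.Ico (M₀ a c) m, Q a c μ σ k v x y < 0
  zero : Q a c μ σ k m x y = 0
  pos : ∀ v ∈ Set.Ioc m 0, 0 < Q a c μ σ k v x y

/-- `p` is the zero of `v ↦ Q₍ₖ₎(v,x,y)` on `[0, ∞)`: this function is negative on `[0, p)`,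
vanishes at `p` and is positive on `(p, ∞)`. Such a `p` is unique. -/
structure IsUpperZero (a c μ σ : ℝ) (k : ℕ) (x y p : ℝ) : Prop where
  nonneg : 0 ≤ p
  neg : ∀ v ∈ Set.Ico 0 p, Q a c μ σ k v x y < 0
  zero : Q a c μ σ k p x y = 0
  pos : ∀ v ∈ Set.Ioi p, 0 < Q a c μ σ k v x y

/-- The implicitly defined function `𝓜₍ₖ₎(x,y)`. -/
def calM (a c μ σ : ℝ) (k : ℕ) (x y : ℝ) : ℝ :=
  Classical.epsilon fun m => IsLowerZero a c μ σ k x y m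

/-- The implicitly defined function `𝓝₍ₖ₎(x,y)`. -/
def calN (a c μ σ : ℝ) (k : ℕ) (x y : ℝ) : ℝ :=
  Classical.epsilon fun p => IsUpperZero a c μ σ k x y p

/-- The pair `(Mₖₙ, Nₖₙ)`, defined recursively. -/
def bounds (a c μ σ : ℝ) (k : ℕ) : ℕ → ℝ × ℝ
  | 0 => (M₀ a c, N₀ a c μ σ)
  | n + 1 =>
    (calM a c μ σ k (bounds a c μ σ k n).2 (bounds a c μ σ k n).1,
      calN a c μ σ k (bounds a c μ σ k n).1 (bounds a c μ σ k n).2)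

/-- `Mₖₙ`. -/
def lowerBd (a c μ σ : ℝ) (k n : ℕ) : ℝ := (bounds a c μ σ k n).1

/-- `Nₖₙ`. -/
def upperBd (a c μ σ : ℝ) (k n : ℕ) : ℝ := (bounds a c μ σ k n).2

end

end Sawtooth

/-!
Write `A = -μ`, `B = -σ`, `ρ = μ / σ ∈ (0, 1]` and `w = a + c v`. After removing the sign
conventions, `Q` is `lowerQ` or `upperQ`: the linear part `v + ρ v exp (-A w)` plus or minus `B`
times `response`, the integral over `[0, w]` of `exp (-A s)` against a worst-case `profile`
(`Q_eq_lowerQ`, `Q_eq_upperQ`).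

*Existence of the zeros.* `lowerQ` is strictly increasing on `[M₀, 0]` (`lowerQ_strictMonoOn`).
`upperQ` need not be monotone, but it changes sign only once, upwards. For `ρ v ≥ X`, with `-X` the
lower bound in use, it is positive (`upperQ_pos_of_le`). For smaller `v`, if the profile reaches its
bound `X` within the interval, there is a closed form whose derivative is positive wherever it is
nonnegative; this rests on the inequality `add_mul_lt_of_mul_exp_le`, which uses `σ ≤ μ` and
`X ≤ a / c`. If the profile stays below `X`, then `upperQ * exp (A w)` is strictly increasing
(`crossesUp_upperQ_two_of_le`). The profile increases strictly with the bounds, so the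
function that determined a bound becomes strictly negative (resp. positive) there once both bounds
have been improved; this is what keeps the nesting strict (`GoodBounds.next`).

*Trapping.* Suppose that `u` stays in `[M, N]`. At a late critical point of `u` the delayed term
equals `-ρ u`, it stays in `[M, N]` and it is Lipschitz with constant `D`, so that the profile
dominates it; variation of constants over one delay then gives `lowerQ ≥ 0` and `upperQ ≤ 0` at the
value of `u` (`lowerQ_nonneg_and_upperQ_nonpos`). Hence `u` has no late critical point outside the
next interval. It cannot remain on one side of that interval, because its derivative would then be
bounded away from `0` with the wrong sign, and an excursion out of the interval between two returns
would contain a critical point (`eventually_ge_of_no_critical`). The iteration starts because `u`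
cannot go below `M₀`, where the delay vanishes and `u' > 0`, and decreases strictly above `N₀`
(`IsSolution.eventually_mem_M₀_N₀`).
-/

namespace Sawtooth

open Set Filter Topology

noncomputable section

/-! ### The normalized functions -/

/-- The largest value that a delayed term bounded by `X` can have at a time `s` before an extremum
of the solution. For `k ≠ 1` it is also taken into account that the delayed term equals `b` at the
extremum and is Lipschitz with constant `D`. -/
def profile (k : ℕ) (D X b s : ℝ) : ℝ := if k = 1 then X else min X (b + D * s)

/-- The profile integrated against the kernel `exp (-A s)` of the linear part. -/
def response (k : ℕ) (A D X b w : ℝ) : ℝ :=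
  ∫ s in (0 : ℝ)..w, Real.exp (-A * s) * profile k D X b s

/-- The function `Q` in its role for the lower bound, with `A = -μ`, `B = -σ`, `ρ = μ / σ`. -/
def lowerQ (k : ℕ) (a c A B ρ D X v : ℝ) : ℝ :=
  v + ρ * v * Real.exp (-A * (a + c * v)) + B * response k A D X (-(ρ * v)) (a + c * v)

/-- The function `Q` in its role for the upper bound, with `A = -μ`, `B = -σ`, `ρ = μ / σ`. The
sign of the lower bound `-X` has been moved in front of the integral. -/
def upperQ (k : ℕ) (a c A B ρ D X v : ℝ) : ℝ :=
  v + ρ * v * Real.exp (-A * (a + c * v)) - B * response k A D X (ρ * v) (a + c * v)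

lemma profile_one (D X b s : ℝ) : profile 1 D X b s = X := by simp [profile]

lemma profile_two (D X b s : ℝ) : profile 2 D X b s = min X (b + D * s) := by simp [profile]

lemma profile_le (k : ℕ) (D X b s : ℝ) : profile k D X b s ≤ X := by
  unfold profile; split_ifs <;> simp

lemma continuous_profile (k : ℕ) (D X : ℝ) :
    Continuous fun p : ℝ × ℝ => profile k D X p.1 p.2 := by
  unfold profile; split_ifs <;> fun_prop

lemma profile_pos {k : ℕ} {D X b s : ℝ} (hX : 0 < X) (h : 0 < b + D * s) :
    0 < profile k D X b s := by
  unfold profile; split_ifs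
  · exact hX
  · exact lt_min hX h

lemma profile_nonneg {k : ℕ} {D X b s : ℝ} (hX : 0 ≤ X) (h : 0 ≤ b + D * s) :
    0 ≤ profile k D X b s := by
  unfold profile; split_ifs
  · exact hX
  · exact le_min hX h

lemma profile_sub_le {k : ℕ} {D X b b' s : ℝ} (h : b ≤ b') :
    profile k D X b' s - profile k D X b s ≤ b' - b := by
  unfold profile; split_ifs
  · linarith
  · rcases min_cases X (b + D * s) with h1 | h1 <;> rcases min_cases X (b' + D * s) with h2 | h2 <;>
      linarith

lemma profile_lt {k : ℕ} {D D' X X' b s : ℝ} (hX : X < X') (hD : D < D') (hs : 0 < s) :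
    profile k D X b s < profile k D' X' b s := by
  have : D * s < D' * s := by gcongr
  unfold profile; split_ifs
  · exact hX
  · exact min_lt_min hX (by linarith)

lemma continuous_integrand (k : ℕ) (A D X b : ℝ) :
    Continuous fun s => Real.exp (-A * s) * profile k D X b s := by
  have := (continuous_profile k D X).comp (Continuous.prodMk_right b)
  exact (by fun_prop : Continuous fun s => Real.exp (-A * s)).mul this

lemma continuous_response (k : ℕ) (A D X : ℝ) {b w : ℝ → ℝ} (hb : Continuous b)
    (hw : Continuous w) : Continuous fun v => response k A D X (b v) (w v) := by
  unfold response
  refine intervalIntegral.continuous_parametric_intervalIntegral_of_continuous ?_ hw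
  have h1 : Continuous fun p : ℝ × ℝ => profile k D X (b p.1) p.2 :=
    (continuous_profile k D X).comp
      (by fun_prop : Continuous fun p : ℝ × ℝ => (b p.1, p.2))
  exact (by fun_prop : Continuous fun p : ℝ × ℝ => Real.exp (-A * p.2)).mul h1

lemma continuous_lowerQ (k : ℕ) (a c A B ρ D X : ℝ) :
    Continuous (lowerQ k a c A B ρ D X) := by
  have := continuous_response k A D X (b := fun v => -(ρ * v)) (w := fun v => a + c * v)
    (by fun_prop) (by fun_prop)
  unfold lowerQ; fun_prop

lemma continuous_upperQ (k : ℕ) (a c A B ρ D X : ℝ) :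
    Continuous (upperQ k a c A B ρ D X) := by
  have := continuous_response k A D X (b := fun v => ρ * v) (w := fun v => a + c * v)
    (by fun_prop) (by fun_prop)
  unfold upperQ; fun_prop

lemma response_zero (k : ℕ) (A D X b : ℝ) : response k A D X b 0 = 0 := by simp [response]

lemma response_pos {k : ℕ} {A D X b w : ℝ} (hX : 0 < X) (hD : 0 < D) (hb : 0 ≤ b) (hw : 0 < w) :
    0 < response k A D X b w := by
  refine intervalIntegral.intervalIntegral_pos_of_pos_on
    ((continuous_integrand k A D X b).intervalIntegrable _ _) (fun s hs => ?_) hw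
  have : 0 < D * s := mul_pos hD hs.1
  exact mul_pos (Real.exp_pos _) (profile_pos hX (by linarith))

lemma response_lt {k : ℕ} {A D D' X X' b w : ℝ} (hX : X < X') (hD : D < D') (hw : 0 < w) :
    response k A D X b w < response k A D' X' b w := by
  have h : 0 < ∫ s in (0 : ℝ)..w, (Real.exp (-A * s) * profile k D' X' b s -
      Real.exp (-A * s) * profile k D X b s) := by
    refine intervalIntegral.intervalIntegral_pos_of_pos_on
      (((continuous_integrand k A D' X' b).sub
        (continuous_integrand k A D X b)).intervalIntegrable _ _) (fun s hs => ?_) hw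
    have := profile_lt (k := k) (b := b) hX hD hs.1
    have := mul_lt_mul_of_pos_left this (Real.exp_pos (-A * s))
    linarith
  rw [intervalIntegral.integral_sub ((continuous_integrand k A D' X' b).intervalIntegrable _ _)
    ((continuous_integrand k A D X b).intervalIntegrable _ _)] at h
  unfold response; linarith

lemma integral_exp_mul {A : ℝ} (hA : A ≠ 0) (l w : ℝ) :
    ∫ s in l..w, Real.exp (-A * s) = (Real.exp (-A * l) - Real.exp (-A * w)) / A := by
  have h : ∀ s : ℝ, HasDerivAt (fun s => -Real.exp (-A * s) / A) (Real.exp (-A * s)) s := by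
    intro s
    have := (((hasDerivAt_id s).const_mul (-A)).exp.neg).div_const A
    refine this.congr_deriv ?_
    simp only [id, mul_one, mul_neg, neg_neg]
    rw [mul_div_assoc, div_self hA, mul_one]
  rw [intervalIntegral.integral_eq_sub_of_hasDerivAt (fun s _ => h s)
    ((by fun_prop : Continuous fun s => Real.exp (-A * s)).intervalIntegrable _ _)]
  ring

lemma response_le {k : ℕ} {A D X b w : ℝ} (hA : 0 < A) (hw : 0 ≤ w) :
    response k A D X b w ≤ X * ((1 - Real.exp (-A * w)) / A) := by
  have h := intervalIntegral.integral_mono_on hw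
    ((continuous_integrand k A D X b).intervalIntegrable (μ := MeasureTheory.volume) 0 w)
    ((by fun_prop : Continuous fun s => Real.exp (-A * s) * X).intervalIntegrable 0 w)
    (fun s _ => mul_le_mul_of_nonneg_left (profile_le k D X b s) (Real.exp_pos _).le)
  rw [intervalIntegral.integral_mul_const, integral_exp_mul hA.ne'] at h
  simp only [mul_zero, Real.exp_zero] at h
  unfold response; linarith

/-- Moving the value `b` down and the length `w` up costs at most the change of `b`, integrated
against the kernel. -/
lemma response_sub_le {k : ℕ} {A D X b b' w w' : ℝ} (hA : 0 < A) (hD : 0 ≤ D) (hX : 0 ≤ X)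
    (hb : 0 ≤ b) (hbb : b ≤ b') (hw : 0 ≤ w) (hww : w ≤ w') :
    response k A D X b' w - response k A D X b w' ≤
      (b' - b) * ((1 - Real.exp (-A * w)) / A) := by
  have hi : ∀ b l r : ℝ, IntervalIntegrable (fun s => Real.exp (-A * s) * profile k D X b s)
      MeasureTheory.volume l r := fun b l r =>
        (continuous_integrand k A D X b).intervalIntegrable _ _
  have h1 : response k A D X b w ≤ response k A D X b w' := by
    unfold response
    rw [← intervalIntegral.integral_add_adjacent_intervals (hi b 0 w) (hi b w w')]
    have : 0 ≤ ∫ s in w..w', Real.exp (-A * s) * profile k D X b s := by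
      refine intervalIntegral.integral_nonneg hww fun s hs => ?_
      have : 0 ≤ D * s := mul_nonneg hD (hw.trans hs.1)
      exact mul_nonneg (Real.exp_pos _).le (profile_nonneg hX (by linarith))
    linarith
  have h2 := intervalIntegral.integral_mono_on hw ((hi b' 0 w).sub (hi b 0 w))
    ((by fun_prop : Continuous fun s => Real.exp (-A * s) * (b' - b)).intervalIntegrable 0 w)
    (fun s _ => by
      have := mul_le_mul_of_nonneg_left (profile_sub_le (k := k) (D := D) (X := X) (s := s) hbb)
        (Real.exp_pos (-A * s)).le
      linarith)
  rw [intervalIntegral.integral_sub (hi b' 0 w) (hi b 0 w), intervalIntegral.integral_mul_const,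
    integral_exp_mul hA.ne'] at h2
  simp only [mul_zero, Real.exp_zero] at h2
  unfold response at *; linarith

/-- The length `a + c * v` grows with `v`, and the loss in the response through the smaller initial
value `-(ρ * v)` is absorbed by the linear part, because `ρ * B = A`. -/
lemma lowerQ_strictMonoOn {k : ℕ} {a c A B ρ D X : ℝ} (hc : 0 < c) (hA : 0 < A)
    (hρ : 0 < ρ) (hB : ρ * B = A) (hD : 0 ≤ D) (hX : 0 ≤ X) :
    StrictMonoOn (lowerQ k a c A B ρ D X) (Icc (-a / c) 0) := by
  intro v hv v' hv' h
  have hB0 : 0 < B := by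
    by_contra! hB'
    nlinarith
  have hw : 0 ≤ a + c * v := by
    have := (div_le_iff₀' hc).1 hv.1
    linarith
  have hcv : c * v < c * v' := by gcongr
  have hr := response_sub_le (k := k) (D := D) (X := X) (b := -(ρ * v')) (b' := -(ρ * v)) hA hD hX
    (by nlinarith [hv'.2]) (by nlinarith) hw (by linarith : a + c * v ≤ a + c * v')
  have hE : Real.exp (-A * (a + c * v')) ≤ Real.exp (-A * (a + c * v)) :=
    Real.exp_le_exp.2 (by nlinarith)
  have hE0 := Real.exp_pos (-A * (a + c * v))
  unfold lowerQ
  set E := Real.exp (-A * (a + c * v))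
  set E' := Real.exp (-A * (a + c * v'))
  have h1 : B * (response k A D X (-(ρ * v)) (a + c * v) -
      response k A D X (-(ρ * v')) (a + c * v')) ≤ (v' - v) * (1 - E) := by
    calc _ ≤ B * ((-(ρ * v) - -(ρ * v')) * ((1 - E) / A)) := by gcongr
      _ = (v' - v) * (1 - E) * (ρ * B / A) := by ring
      _ = _ := by rw [hB, div_self hA.ne', mul_one]
  have h2 : ρ * v' * E ≤ ρ * v' * E' :=
    mul_le_mul_of_nonpos_left hE (by nlinarith [hv'.2])
  nlinarith [mul_pos (mul_pos hρ (sub_pos.2 h)) hE0, mul_pos (sub_pos.2 h) hE0]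

lemma lowerQ_left_neg {k : ℕ} {a c A B ρ D X : ℝ} (ha : 0 < a) (hc : 0 < c) (hρ : 0 < ρ) :
    lowerQ k a c A B ρ D X (-a / c) < 0 := by
  have h : a + c * (-a / c) = 0 := by field_simp; ring
  have h' : -a / c < 0 := div_neg_of_neg_of_pos (by linarith) hc
  simp only [lowerQ, h, response_zero, mul_zero, Real.exp_zero]
  nlinarith

lemma lowerQ_zero_pos {k : ℕ} {a c A B ρ D X : ℝ} (ha : 0 < a) (hB : 0 < B) (hD : 0 < D)
    (hX : 0 < X) : 0 < lowerQ k a c A B ρ D X 0 := by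
  have := response_pos (k := k) (A := A) hX hD le_rfl ha
  simp only [lowerQ, mul_zero, neg_zero, add_zero, zero_mul, zero_add]
  positivity

lemma upperQ_zero_neg {k : ℕ} {a c A B ρ D X : ℝ} (ha : 0 < a) (hB : 0 < B) (hD : 0 < D)
    (hX : 0 < X) : upperQ k a c A B ρ D X 0 < 0 := by
  have := mul_pos hB (response_pos (k := k) (A := A) hX hD le_rfl ha)
  simp only [upperQ, mul_zero, add_zero, zero_mul, zero_sub]
  linarith

/-- Bounding the profile by `X` is sharp enough for `X ≤ ρ * v`. -/
lemma upperQ_pos_of_le {k : ℕ} {a c A B ρ D X v : ℝ} (ha : 0 < a) (hc : 0 < c) (hA : 0 < A)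
    (hρ : 0 < ρ) (hB : ρ * B = A) (hX : 0 < X) (hv : X ≤ ρ * v) :
    0 < upperQ k a c A B ρ D X v := by
  have hv0 : 0 < v := by by_contra! h; nlinarith
  have hB0 : 0 < B := by
    by_contra! hB'
    nlinarith
  have hw : 0 ≤ a + c * v := by positivity
  have hr := response_le (k := k) (D := D) (X := X) (b := ρ * v) hA hw
  unfold upperQ
  have hE0 := Real.exp_pos (-A * (a + c * v))
  have hE1 : Real.exp (-A * (a + c * v)) ≤ 1 := Real.exp_le_one_iff.2 (by nlinarith)
  set E := Real.exp (-A * (a + c * v))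
  have h1 : B * response k A D X (ρ * v) (a + c * v) ≤ v * (1 - E) := by
    calc _ ≤ B * (X * ((1 - E) / A)) := by gcongr
      _ ≤ B * (ρ * v * ((1 - E) / A)) := by
        have : 0 ≤ (1 - E) / A := div_nonneg (by linarith) hA.le
        gcongr
      _ = v * (1 - E) * (ρ * B / A) := by ring
      _ = _ := by rw [hB, div_self hA.ne', mul_one]
  nlinarith [mul_pos (mul_pos hρ hv0) hE0, mul_pos hv0 hE0]

/-! ### Uniqueness of the upper zero -/

/-- Once `f` is nonnegative at a point of `s`, it is positive at all later points of `s`. -/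
def CrossesUp (f : ℝ → ℝ) (s : Set ℝ) : Prop := ∀ x ∈ s, ∀ y ∈ s, x < y → 0 ≤ f x → 0 < f y

lemma crossesUp_of_hasDerivAt {f f' : ℝ → ℝ} {l r : ℝ}
    (hf : ∀ v ∈ Icc l r, HasDerivAt f (f' v) v) (hpos : ∀ v ∈ Icc l r, 0 ≤ f v → 0 < f' v) :
    CrossesUp f (Icc l r) := by
  intro x hx y hy hxy h0
  have hsub : Icc x y ⊆ Icc l r := Icc_subset_Icc hx.1 hy.2
  have hcont : ContinuousOn f (Icc x y) := fun v hv =>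
    (hf v (hsub hv)).continuousAt.continuousWithinAt
  have hnn : ∀ v ∈ Icc x y, 0 ≤ f v := by
    intro v hv
    have := image_le_of_deriv_right_lt_deriv_boundary' (f := fun v => -f v) (f' := fun v => -f' v)
      (B := fun _ => (0 : ℝ)) (B' := fun _ => (0 : ℝ)) hcont.neg
      (fun v hv => (hf v (hsub (Ico_subset_Icc_self hv))).neg.hasDerivWithinAt) (by simpa using h0)
      continuousOn_const (fun v _ => hasDerivWithinAt_const _ _ _)
      (fun v hv h => by
        have := hpos v (hsub (Ico_subset_Icc_self hv)) (by linarith)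
        linarith) hv
    linarith
  have hmono : StrictMonoOn f (Icc x y) := by
    refine strictMonoOn_of_deriv_pos (convex_Icc x y) hcont fun v hv => ?_
    rw [interior_Icc] at hv
    have hv' := Ioo_subset_Icc_self hv
    rw [(hf v (hsub hv')).deriv]
    exact hpos v (hsub hv') (hnn v hv')
  exact h0.trans_lt (hmono (left_mem_Icc.2 hxy.le) (right_mem_Icc.2 hxy.le) hxy)

lemma CrossesUp.of_pos_mul {f g h : ℝ → ℝ} {s : Set ℝ} (hg : CrossesUp g s)
    (hh : ∀ v ∈ s, 0 < h v) (hf : ∀ v ∈ s, f v = h v * g v) : CrossesUp f s := by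
  intro x hx y hy hxy h0
  rw [hf x hx] at h0
  rw [hf y hy]
  exact mul_pos (hh y hy) (hg x hx y hy hxy (nonneg_of_mul_nonneg_right h0 (hh x hx)))

lemma _root_.StrictMonoOn.crossesUp {f : ℝ → ℝ} {s : Set ℝ} (hf : StrictMonoOn f s) :
    CrossesUp f s := fun _ hx _ hy hxy h0 => h0.trans_lt (hf hx hy hxy)

lemma CrossesUp.append {f : ℝ → ℝ} {l m r : ℝ} (h1 : CrossesUp f (Icc l m))
    (h2 : CrossesUp f (Icc m r)) : CrossesUp f (Icc l r) := by
  intro x hx y hy hxy h0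
  rcases le_total y m with hym | hym
  · exact h1 x ⟨hx.1, hxy.le.trans hym⟩ y ⟨hy.1, hym⟩ hxy h0
  rcases le_total m x with hmx | hmx
  · exact h2 x ⟨hmx, hx.2⟩ y ⟨hym, hy.2⟩ hxy h0
  have hm : 0 ≤ f m := by
    rcases hmx.eq_or_lt with rfl | hlt
    · exact h0
    · exact (h1 x ⟨hx.1, hmx⟩ m ⟨hx.1.trans hmx, le_rfl⟩ hlt h0).le
  rcases hym.eq_or_lt with rfl | hlt
  · exact h1 x ⟨hx.1, hmx⟩ m ⟨hx.1.trans hmx, le_rfl⟩ hxy h0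
  · exact h2 m ⟨le_rfl, hym.trans hy.2⟩ y ⟨hym, hy.2⟩ hlt hm

/-- The inequality behind the uniqueness of the upper zero. Eliminating `b` and then `Y` from the
hypotheses reduces it to `s * exp t < (ρ + exp t) * (exp t - 1 + ρ)`, and this follows from
`s < exp t - 1 + ρ + ρ ^ 2` because the difference is `ρ * (1 - ρ) * (exp t - 1)`. -/
lemma add_mul_lt_of_mul_exp_le {ρ s t z Y b : ℝ} (hρ : 0 < ρ) (hρ1 : ρ ≤ 1) (hs : s = t + z)
    (ht : 0 ≤ t) (hz : z < ρ + ρ ^ 2) (hb : b ≤ s - Y)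
    (h : Y * Real.exp t ≤ Y + ρ * b) : Y + ρ * b < ρ ^ 2 + ρ * Real.exp t := by
  have he := Real.add_one_le_exp t
  set e := Real.exp t
  have hp : 0 < e - 1 + ρ := by linarith
  have h1 : Y * (e - 1 + ρ) ≤ ρ * s := by nlinarith
  have h2 : Y + ρ * b ≤ (1 - ρ) * Y + ρ * s := by nlinarith
  have h3 : s * e < (ρ + e) * (e - 1 + ρ) := by
    have h4 : s * e < (e - 1 + ρ + ρ ^ 2) * e := by
      refine mul_lt_mul_of_pos_right ?_ (by linarith)
      linarith
    have h5 : 0 ≤ ρ * (1 - ρ) * (e - 1) := by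
      refine mul_nonneg (mul_nonneg hρ.le ?_) ?_ <;> linarith
    nlinarith
  refine lt_of_mul_lt_mul_right ?_ hp.le
  calc (Y + ρ * b) * (e - 1 + ρ) ≤ ((1 - ρ) * Y + ρ * s) * (e - 1 + ρ) := by gcongr
    _ = (1 - ρ) * (Y * (e - 1 + ρ)) + ρ * s * (e - 1 + ρ) := by ring
    _ ≤ (1 - ρ) * (ρ * s) + ρ * s * (e - 1 + ρ) := by
      have : 0 ≤ 1 - ρ := by linarith
      gcongr
    _ = ρ * (s * e) := by ring
    _ < ρ * ((ρ + e) * (e - 1 + ρ)) := by gcongr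
    _ = _ := by ring

/-- The closed form of `ρ * upperQ` where the profile reaches its bound `X`: here `Ψ` is the
identity for `k = 1`, and `Ψ y = (D / A) * (1 - exp (-A * y / D))` for `k = 2`. -/
lemma crossesUp_closedForm {a c A ρ X l r : ℝ} {Ψ z : ℝ → ℝ} (hc : 0 < c)
    (hA : 0 < A) (hρ : 0 < ρ) (hρ1 : ρ ≤ 1) (hXa : c * X ≤ a)
    (hΨ : ∀ v ∈ Icc l r, HasDerivAt Ψ (Real.exp (-z v)) (X - ρ * v))
    (hΨz : ∀ v ∈ Icc l r, (X - ρ * v) * Real.exp (-z v) ≤ Ψ (X - ρ * v))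
    (hzρ : ∀ v ∈ Icc l r, z v < ρ + ρ ^ 2) (hzw : ∀ v ∈ Icc l r, z v ≤ A * (a + c * v)) :
    CrossesUp (fun v => Real.exp (-A * (a + c * v)) * (X + ρ ^ 2 * v) - Ψ (X - ρ * v))
      (Icc l r) := by
  refine crossesUp_of_hasDerivAt
    (f' := fun v => -(A * c) * Real.exp (-A * (a + c * v)) * (X + ρ ^ 2 * v) +
      ρ ^ 2 * Real.exp (-A * (a + c * v)) + ρ * Real.exp (-z v)) (fun v hv => ?_) fun v hv h0 => ?_
  · have h1 : HasDerivAt (fun v => Real.exp (-A * (a + c * v)))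
        (Real.exp (-A * (a + c * v)) * (-A * (c * 1))) v :=
      ((((hasDerivAt_id v).const_mul c).const_add a).const_mul (-A)).exp
    have h2 : HasDerivAt (fun v => X + ρ ^ 2 * v) (ρ ^ 2 * 1) v :=
      ((hasDerivAt_id v).const_mul (ρ ^ 2)).const_add X
    have h3 : HasDerivAt (fun v => X - ρ * v) (-(ρ * 1)) v :=
      ((hasDerivAt_id v).const_mul ρ).const_sub X
    refine ((h1.mul h2).sub ((hΨ v hv).comp v h3)).congr_deriv ?_
    ring
  · have hAc : 0 < A * c := mul_pos hA hc
    set s := A * (a + c * v) with hs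
    have hE : -A * (a + c * v) = -s := by rw [hs]; ring
    simp only [hE] at h0 ⊢
    have h1 : (X - ρ * v) * Real.exp (-z v) ≤ Real.exp (-s) * (X + ρ ^ 2 * v) := by
      linarith [hΨz v hv]
    have hmul : Real.exp s * Real.exp (-s) = 1 := by rw [← Real.exp_add]; simp
    have hmz : Real.exp s * Real.exp (-z v) = Real.exp (s - z v) := by
      rw [← Real.exp_add]; ring_nf
    have h2 : A * c * (X - ρ * v) * Real.exp (s - z v) ≤
        A * c * (X - ρ * v) + ρ * ((1 + ρ) * (A * c * v)) := by
      calc _ = A * c * Real.exp s * ((X - ρ * v) * Real.exp (-z v)) := by rw [← hmz]; ring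
        _ ≤ A * c * Real.exp s * (Real.exp (-s) * (X + ρ ^ 2 * v)) := by
          have := Real.exp_pos s
          gcongr
        _ = A * c * (X + ρ ^ 2 * v) * (Real.exp s * Real.exp (-s)) := by ring
        _ = _ := by rw [hmul]; ring
    -- applied with `Y = A c (X - ρ v)` and `b = (1 + ρ) A c v`; then `Y + ρ b = A c (X + ρ² v)`
    have h3 := add_mul_lt_of_mul_exp_le hρ hρ1 (by ring : s = (s - z v) + z v)
      (by linarith [hzw v hv]) (hzρ v hv) (by rw [hs]; nlinarith) h2
    have h4 := mul_lt_mul_of_pos_left h3 (Real.exp_pos (-s))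
    have h5 : Real.exp (-s) * Real.exp (s - z v) = Real.exp (-z v) := by
      rw [← Real.exp_add]; ring_nf
    have h6 : Real.exp (-s) * (ρ ^ 2 + ρ * Real.exp (s - z v)) =
        ρ ^ 2 * Real.exp (-s) + ρ * Real.exp (-z v) := by
      rw [← h5]; ring
    rw [h6] at h4
    linarith

lemma response_one {A D X b w : ℝ} (hA : A ≠ 0) :
    response 1 A D X b w = X * ((1 - Real.exp (-A * w)) / A) := by
  simp only [response, profile_one]
  rw [intervalIntegral.integral_mul_const, integral_exp_mul hA]
  simp [mul_comm]

lemma integral_exp_mul_affine {A : ℝ} (hA : A ≠ 0) (D b w : ℝ) :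
    ∫ s in (0 : ℝ)..w, Real.exp (-A * s) * (b + D * s) =
      b / A + D / A ^ 2 - Real.exp (-A * w) * ((b + D * w) / A + D / A ^ 2) := by
  have h : ∀ s : ℝ, HasDerivAt (fun s => -(Real.exp (-A * s) * ((b + D * s) / A + D / A ^ 2)))
      (Real.exp (-A * s) * (b + D * s)) s := by
    intro s
    have h1 : HasDerivAt (fun s => Real.exp (-A * s)) (Real.exp (-A * s) * (-A * 1)) s :=
      ((hasDerivAt_id s).const_mul (-A)).exp
    have h2 : HasDerivAt (fun s => (b + D * s) / A + D / A ^ 2) (D * 1 / A) s :=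
      ((((hasDerivAt_id s).const_mul D).const_add b).div_const A).add_const _
    refine (h1.mul h2).neg.congr_deriv ?_
    field_simp
    ring
  rw [intervalIntegral.integral_eq_sub_of_hasDerivAt (fun s _ => h s)
    ((by fun_prop : Continuous fun s => Real.exp (-A * s) * (b + D * s)).intervalIntegrable _ _)]
  simp
  ring

/-- The response when the profile stays below its bound `X` on the whole interval. -/
lemma response_two_of_le {A D X b w : ℝ} (hA : A ≠ 0) (hD : 0 ≤ D) (hw : 0 ≤ w)
    (h : b + D * w ≤ X) : response 2 A D X b w =
      b / A + D / A ^ 2 - Real.exp (-A * w) * ((b + D * w) / A + D / A ^ 2) := by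
  rw [← integral_exp_mul_affine hA]
  refine intervalIntegral.integral_congr fun s hs => ?_
  rw [uIcc_of_le hw] at hs
  have : D * s ≤ D * w := by gcongr; exact hs.2
  simp only [profile_two]
  rw [min_eq_right (by linarith)]

/-- The response when the profile reaches its bound `X` at `s = (X - b) / D ≤ w`. -/
lemma response_two_of_ge {A D X b w : ℝ} (hA : A ≠ 0) (hD : 0 < D) (hb : b ≤ X)
    (h : X ≤ b + D * w) : response 2 A D X b w =
      X / A * (1 - Real.exp (-A * w)) -
        ((X - b) / A - D / A ^ 2 * (1 - Real.exp (-(A * (X - b) / D)))) := by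
  set r := (X - b) / D with hr
  have hr0 : 0 ≤ r := div_nonneg (by linarith) hD.le
  have hDr : D * r = X - b := by rw [hr]; field_simp
  have hrw : r ≤ w := by rw [hr, div_le_iff₀' hD]; linarith
  have hi : ∀ l r : ℝ, IntervalIntegrable (fun s => Real.exp (-A * s) * profile 2 D X b s)
      MeasureTheory.volume l r := fun l r => (continuous_integrand 2 A D X b).intervalIntegrable _ _
  have h2 : ∫ s in r..w, Real.exp (-A * s) * profile 2 D X b s =
      (Real.exp (-A * r) - Real.exp (-A * w)) / A * X := by
    rw [← integral_exp_mul hA, ← intervalIntegral.integral_mul_const]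
    refine intervalIntegral.integral_congr fun s hs => ?_
    rw [uIcc_of_le hrw] at hs
    have : D * r ≤ D * s := by gcongr; exact hs.1
    simp only [profile_two]
    rw [min_eq_left (by linarith)]
  have h1 := response_two_of_le hA hD.le hr0 (by linarith : b + D * r ≤ X)
  have h3 : -(A * (X - b) / D) = -A * r := by rw [hr]; ring
  unfold response at h1 ⊢
  rw [← intervalIntegral.integral_add_adjacent_intervals (hi 0 r) (hi r w), h1, h2, h3, hDr]
  field_simp
  ring

lemma crossesUp_upperQ_one {a c A B ρ D X : ℝ} (ha : 0 < a) (hc : 0 < c) (hA : 0 < A)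
    (hρ : 0 < ρ) (hρ1 : ρ ≤ 1) (hB : ρ * B = A) (hXa : c * X ≤ a) :
    CrossesUp (upperQ 1 a c A B ρ D X) (Icc 0 (X / ρ)) := by
  have hcf := crossesUp_closedForm (l := 0) (r := X / ρ) (Ψ := fun y => y) (z := fun _ => 0)
    hc hA hρ hρ1 hXa (fun v _ => by simpa using hasDerivAt_id' (X - ρ * v))
    (fun v _ => by simp) (fun v _ => by positivity)
    (fun v hv => by have := hv.1; positivity)
  refine hcf.of_pos_mul (h := fun _ => 1 / ρ) (fun _ _ => by positivity) fun v _ => ?_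
  simp only [upperQ, response_one hA.ne']
  rw [← hB]
  have : B ≠ 0 := by rintro rfl; simp at hB; exact hA.ne hB
  field_simp
  ring

lemma crossesUp_upperQ_two_of_ge {a c A B ρ D X l : ℝ} (hc : 0 < c) (hA : 0 < A)
    (hρ : 0 < ρ) (hρ1 : ρ ≤ 1) (hB : ρ * B = A) (hXa : c * X ≤ a) (hX : 0 < X)
    (hD : (A + B) * X ≤ D) (hl0 : 0 ≤ l)
    (hl : ∀ v ∈ Icc l (X / ρ), X ≤ ρ * v + D * (a + c * v)) :
    CrossesUp (upperQ 2 a c A B ρ D X) (Icc l (X / ρ)) := by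
  have hB0 : 0 < B := by
    by_contra! hB'
    nlinarith
  have hD0 : 0 < D := lt_of_lt_of_le (by positivity) hD
  have hz : ∀ v : ℝ, 0 ≤ v → A * (X - ρ * v) / D < ρ + ρ ^ 2 := by
    intro v hv
    rw [div_lt_iff₀ hD0]
    have h1 : A * (X - ρ * v) ≤ A * X := by
      have : 0 ≤ A * (ρ * v) := by positivity
      linarith
    have h2 : A * X = ρ * (B * X) := by rw [← hB]; ring
    have h3 : ρ * (B * X) < ρ * ((A + B) * X) := by
      have := mul_pos hA hX
      gcongr
      linarith
    have h4 : ρ * ((A + B) * X) ≤ ρ * D := by gcongr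
    have h5 : 0 < ρ ^ 2 * D := by positivity
    linarith
  have hcf := crossesUp_closedForm (l := l) (r := X / ρ) (a := a)
    (Ψ := fun y => D / A * (1 - Real.exp (-(A * y / D))))
    (z := fun v => A * (X - ρ * v) / D) hc hA hρ hρ1 hXa (fun v _ => ?_) (fun v _ => ?_)
    (fun v hv => hz v (hl0.trans hv.1)) (fun v hv => ?_)
  · refine hcf.of_pos_mul (h := fun _ => 1 / ρ) (fun _ _ => by positivity) fun v hv => ?_
    have hv' : ρ * v ≤ X := (le_div_iff₀' hρ).1 hv.2
    simp only [upperQ, response_two_of_ge hA.ne' hD0 hv' (hl v hv)]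
    rw [← hB]
    field_simp
    ring
  · have h1 : HasDerivAt (fun y => Real.exp (-(A * y / D)))
        (Real.exp (-(A * (X - ρ * v) / D)) * (-(A * 1 / D))) (X - ρ * v) :=
      (((hasDerivAt_id (X - ρ * v)).const_mul A).div_const D).neg.exp
    refine ((h1.const_sub 1).const_mul (D / A)).congr_deriv ?_
    field_simp
  · set y := X - ρ * v
    set z := A * y / D with hz
    have h1 : z * Real.exp (-z) ≤ 1 - Real.exp (-z) := by
      have h2 := Real.add_one_le_exp z
      have h3 : Real.exp z * Real.exp (-z) = 1 := by rw [← Real.exp_add]; simp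
      nlinarith [Real.exp_pos (-z)]
    have h2 : y = D / A * z := by rw [hz]; field_simp
    calc y * Real.exp (-z) = D / A * (z * Real.exp (-z)) := by rw [← mul_assoc, ← h2]
      _ ≤ _ := by gcongr
  · rw [div_le_iff₀ hD0]
    have := mul_le_mul_of_nonneg_left (hl v hv) hA.le
    linarith

/-- Where the profile stays below its bound, `upperQ * exp (A w)` is strictly increasing: there
`(A + B) w ≤ 1`, which keeps the derivative of the integral term below `1 + ρ`. -/
lemma crossesUp_upperQ_two_of_le {a c A B ρ D X r : ℝ} (ha : 0 < a) (hc : 0 < c) (hA : 0 < A)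
    (hρ : 0 < ρ) (hB : ρ * B = A) (hXa : c * X ≤ a) (hX : 0 < X)
    (hD : (A + B) * X ≤ D) (hr : ∀ v ∈ Icc 0 r, ρ * v + D * (a + c * v) ≤ X) :
    CrossesUp (upperQ 2 a c A B ρ D X) (Icc 0 r) := by
  have hB0 : 0 < B := by
    by_contra! hB'
    nlinarith
  have hD0 : 0 < D := lt_of_lt_of_le (by positivity) hD
  have hmono : StrictMonoOn (fun v => v * (1 + ρ) -
      B * D / A ^ 2 * (Real.exp (A * (a + c * v)) - 1 - A * (a + c * v))) (Icc 0 r) := by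
    intro v hv v' hv' hlt
    set w' := a + c * v' with hw'
    set w := a + c * v with hw
    have hv0 := hv.1
    have hv0' := hv'.1
    have haw : a ≤ w' := by rw [hw']; have : 0 ≤ c * v' := by positivity
                            linarith
    have hw0 : 0 < w' := ha.trans_le haw
    have hww : w' - w = c * (v' - v) := by rw [hw, hw']; ring
    have hcv : 0 < c * (v' - v) := mul_pos hc (sub_pos.2 hlt)
    have hDw : D * w' ≤ X := by
      have := hr v' hv'
      have : 0 ≤ ρ * v' := by positivity
      linarith
    -- from `(A + B) X w' ≤ D w' ≤ X`
    have hABw : (A + B) * w' ≤ 1 := by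
      have : (A + B) * X * w' ≤ 1 * X :=
        (mul_le_mul_of_nonneg_right hD hw0.le).trans (by linarith)
      exact le_of_mul_le_mul_right (by linarith) hX
    have hexp1 : Real.exp (A * w') - Real.exp (A * w) ≤ Real.exp (A * w') * (A * (w' - w)) := by
      have h1 := Real.add_one_le_exp (A * w - A * w')
      have h2 : Real.exp (A * w) = Real.exp (A * w') * Real.exp (A * w - A * w') := by
        rw [← Real.exp_add]; ring_nf
      nlinarith [Real.exp_pos (A * w')]
    have hexp2 : Real.exp (A * w') - 1 ≤ A * w' * (1 + ρ) := by
      have h1 := Real.add_one_le_exp (-(A * w'))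
      have h2 : Real.exp (A * w') * Real.exp (-(A * w')) = 1 := by rw [← Real.exp_add]; simp
      have h3 : Real.exp (A * w') * (1 - A * w') ≤ 1 := by
        nlinarith [Real.exp_pos (A * w')]
      have hAw : 0 < A * w' := by positivity
      have h4 : A * w' * (1 + ρ) ≤ ρ := by
        have := mul_le_mul_of_nonneg_left hABw hρ.le
        nlinarith
      have h5 : 1 ≤ (1 + A * w' * (1 + ρ)) * (1 - A * w') := by nlinarith
      have h6 : A * w' < 1 := by nlinarith
      by_contra! h7
      nlinarith
    have hsmall : B * D * c * w' < 1 := by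
      calc B * D * c * w' = B * c * (D * w') := by ring
        _ ≤ B * c * X := by gcongr
        _ = B * (c * X) := by ring
        _ ≤ B * a := by gcongr
        _ ≤ B * w' := by gcongr
        _ < (A + B) * w' := by gcongr; linarith
        _ ≤ 1 := hABw
    have hdiff : B * D / A ^ 2 * ((Real.exp (A * w') - 1 - A * w') -
        (Real.exp (A * w) - 1 - A * w)) < (1 + ρ) * (v' - v) := by
      calc _ ≤ B * D / A ^ 2 * ((Real.exp (A * w') - 1) * (A * (w' - w))) := by
            gcongr
            linarith
        _ ≤ B * D / A ^ 2 * ((A * w' * (1 + ρ)) * (A * (w' - w))) := by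
            rw [hww]
            gcongr
        _ = B * D * c * w' * ((1 + ρ) * (v' - v)) := by rw [hww]; field_simp
        _ < 1 * ((1 + ρ) * (v' - v)) := by
            have : 0 < v' - v := sub_pos.2 hlt
            gcongr
        _ = _ := one_mul _
    change v * (1 + ρ) - B * D / A ^ 2 * (Real.exp (A * w) - 1 - A * w) <
      v' * (1 + ρ) - B * D / A ^ 2 * (Real.exp (A * w') - 1 - A * w')
    linarith
  refine hmono.crossesUp.of_pos_mul (h := fun v => Real.exp (-A * (a + c * v)))
    (fun _ _ => Real.exp_pos _) fun v hv => ?_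
  have hv0 := hv.1
  have hmul : Real.exp (-A * (a + c * v)) * Real.exp (A * (a + c * v)) = 1 := by
    rw [← Real.exp_add]; ring_nf; simp
  simp only [upperQ, response_two_of_le hA.ne' hD0.le (by positivity : 0 ≤ a + c * v) (hr v hv)]
  set E := Real.exp (-A * (a + c * v))
  set E' := Real.exp (A * (a + c * v))
  have : E * (v * (1 + ρ) - B * D / A ^ 2 * (E' - 1 - A * (a + c * v))) =
    E * (v * (1 + ρ) + B * D / A ^ 2 * (1 + A * (a + c * v))) - B * D / A ^ 2 * (E * E') := by ring
  rw [this, hmul, ← hB]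
  field_simp
  ring

/-! ### The recursion for the bounds -/

lemma crossesUp_upperQ {k : ℕ} (hk : k = 1 ∨ k = 2) {a c A B ρ D X : ℝ} (ha : 0 < a) (hc : 0 < c)
    (hA : 0 < A) (hρ : 0 < ρ) (hρ1 : ρ ≤ 1) (hB : ρ * B = A) (hXa : c * X ≤ a) (hX : 0 < X)
    (hD0 : 0 < D) (hD : (A + B) * X ≤ D) : CrossesUp (upperQ k a c A B ρ D X) (Icc 0 (X / ρ)) := by
  rcases hk with rfl | rfl
  · exact crossesUp_upperQ_one ha hc hA hρ hρ1 hB hXa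
  have hp : 0 < ρ + D * c := by positivity
  -- `m` is where the profile on the interval of length `a + c * m` just reaches its bound
  set m := (X - D * a) / (ρ + D * c) with hm
  have hm' : (ρ + D * c) * m = X - D * a := by rw [hm]; field_simp
  rcases le_total m 0 with h0 | h0
  · refine crossesUp_upperQ_two_of_ge hc hA hρ hρ1 hB hXa hX hD le_rfl fun v hv => ?_
    have := mul_le_mul_of_nonneg_left (h0.trans hv.1) hp.le
    linarith
  · refine (crossesUp_upperQ_two_of_le ha hc hA hρ hB hXa hX hD fun v hv => ?_).append
      (crossesUp_upperQ_two_of_ge hc hA hρ hρ1 hB hXa hX hD h0 fun v hv => ?_)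
    · have := mul_le_mul_of_nonneg_left hv.2 hp.le
      linarith
    · have := mul_le_mul_of_nonneg_left hv.1 hp.le
      linarith

lemma abs_add_abs_pos {μ σ : ℝ} (hμ : μ < 0) : 0 < |μ| + |σ| := by
  have := abs_pos.2 hμ.ne
  positivity

lemma abs_mul_le_D {c μ σ x y : ℝ} (hc : 0 < c) :
    (|μ| + |σ|) * max |x| |y| ≤ D c μ σ x y := by
  have hR : 0 ≤ max |x| |y| := (abs_nonneg x).trans (le_max_left _ _)
  have h1 : 0 ≤ (|μ| + |σ|) * max |x| |y| * c := by positivity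
  unfold D
  calc (|μ| + |σ|) * max |x| |y| = (|μ| + |σ|) * 1 * max |x| |y| := by ring
    _ ≤ _ := by gcongr; linarith

lemma D_pos {c μ σ x y : ℝ} (hc : 0 < c) (hμ : μ < 0) (hx : x ≠ 0) : 0 < D c μ σ x y := by
  have hR : 0 < max |x| |y| := (abs_pos.2 hx).trans_le (le_max_left _ _)
  exact (mul_pos (abs_add_abs_pos hμ) hR).trans_le (abs_mul_le_D hc)

lemma D_comm (c μ σ x y : ℝ) : D c μ σ x y = D c μ σ y x := by unfold D; rw [max_comm]

lemma D_lt_D {c μ σ x y x' y' : ℝ} (hc : 0 < c) (hμ : μ < 0) (hx : |x| < |x'|) (hy : |y| < |y'|) :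
    D c μ σ x y < D c μ σ x' y' := by
  have hR : max |x| |y| < max |x'| |y'| := max_lt_max hx hy
  have hR0 : 0 ≤ max |x| |y| := (abs_nonneg x).trans (le_max_left _ _)
  have hS := abs_add_abs_pos (σ := σ) hμ
  unfold D
  gcongr

/-- Substituting `θ = -s`. Only `s > 0` matters, so the value of `H` at `θ = 0` plays no role. -/
lemma Q_eq_of_eqOn {a c μ σ v x y : ℝ} {k : ℕ} (hw : 0 ≤ a + c * v) {g : ℝ → ℝ}
    (h : ∀ s, 0 < s → H c μ σ k v x y (-s) = g s) : Q a c μ σ k v x y =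
      v + μ / σ * v * Real.exp (μ * (a + c * v)) -
        σ * ∫ s in (0 : ℝ)..(a + c * v), Real.exp (μ * s) * g s := by
  have h1 := intervalIntegral.integral_comp_neg (a := 0) (b := a + c * v)
    (fun θ => Real.exp (-μ * θ) * H c μ σ k v x y θ)
  rw [neg_zero, show -(a + c * v) = -a - c * v by ring] at h1
  unfold Q
  rw [← h1]
  congr 2
  refine intervalIntegral.integral_congr_ae (Filter.Eventually.of_forall fun s hs => ?_)
  rw [uIoc_of_le hw] at hs
  simp only [h s hs.1, neg_mul_neg]

lemma H_lower_eq {k : ℕ} (hk : k = 1 ∨ k = 2) {c μ σ v x y s : ℝ} (hxy : y < x)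
    (hD : 0 < D c μ σ x y) (hs : 0 < s) :
    H c μ σ k v x y (-s) = profile k (D c μ σ x y) x (-(μ / σ * v)) s := by
  rcases hk with rfl | rfl
  · simp [H, H₁, profile, hs]
  have h1 : μ * v / σ = μ / σ * v := by ring
  simp only [H, H₂, profile_two, Real.sign_of_neg (sub_neg.2 hxy), h1]
  rw [if_neg (by norm_num)]
  have hiff : -s ≤ -1 * ((x + μ / σ * v) / D c μ σ x y) ↔ x + μ / σ * v ≤ D c μ σ x y * s := by
    rw [neg_one_mul, neg_le_neg_iff, div_le_iff₀' hD]
  simp only [hiff]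
  split_ifs with h
  · rw [min_eq_left (by linarith)]
  · rw [min_eq_right (by linarith)]; ring

lemma H_upper_eq {k : ℕ} (hk : k = 1 ∨ k = 2) {c μ σ v x y s : ℝ} (hxy : x < y)
    (hD : 0 < D c μ σ x y) (hs : 0 < s) :
    H c μ σ k v x y (-s) = -profile k (D c μ σ x y) (-x) (μ / σ * v) s := by
  rcases hk with rfl | rfl
  · simp [H, H₁, profile, hs]
  have h1 : μ * v / σ = μ / σ * v := by ring
  simp only [H, H₂, profile_two, Real.sign_of_pos (sub_pos.2 hxy), h1]
  rw [if_neg (by norm_num)]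
  have hiff : -s ≤ 1 * ((x + μ / σ * v) / D c μ σ x y) ↔ -(D c μ σ x y * s) ≤ x + μ / σ * v := by
    rw [one_mul, le_div_iff₀' hD, mul_neg]
  simp only [hiff]
  split_ifs with h
  · rw [min_eq_left (by linarith)]; ring
  · rw [min_eq_right (by linarith)]; ring

lemma Q_eq_lowerQ {k : ℕ} (hk : k = 1 ∨ k = 2) {a c μ σ v x y : ℝ} (hxy : y < x)
    (hD : 0 < D c μ σ x y) (hw : 0 ≤ a + c * v) :
    Q a c μ σ k v x y = lowerQ k a c (-μ) (-σ) (μ / σ) (D c μ σ x y) x v := by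
  rw [Q_eq_of_eqOn hw fun s hs => H_lower_eq hk hxy hD hs]
  simp only [lowerQ, response, neg_neg]
  ring

lemma Q_eq_upperQ {k : ℕ} (hk : k = 1 ∨ k = 2) {a c μ σ v x y : ℝ} (hxy : x < y)
    (hD : 0 < D c μ σ x y) (hw : 0 ≤ a + c * v) :
    Q a c μ σ k v x y = upperQ k a c (-μ) (-σ) (μ / σ) (D c μ σ x y) (-x) v := by
  rw [Q_eq_of_eqOn hw fun s hs => H_upper_eq hk hxy hD hs]
  simp only [upperQ, response, neg_neg, mul_neg, intervalIntegral.integral_neg]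
  ring

lemma add_mul_nonneg_of_M₀_le {a c v : ℝ} (hc : 0 < c) (hv : M₀ a c ≤ v) : 0 ≤ a + c * v := by
  have := (div_le_iff₀' hc).1 hv
  linarith

lemma div_mul_neg_self {μ σ : ℝ} (hσ : σ ≠ 0) : μ / σ * (-σ) = -μ := by
  rw [mul_neg, div_mul_cancel₀ _ hσ]

lemma exists_isLowerZero {k : ℕ} (hk : k = 1 ∨ k = 2) {a c μ σ x y : ℝ} (ha : 0 < a) (hc : 0 < c)
    (hσμ : σ ≤ μ) (hμ : μ < 0) (hx : 0 < x) (hy : y < 0) :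
    ∃ m, IsLowerZero a c μ σ k x y m := by
  have hσ : σ < 0 := hσμ.trans_lt hμ
  have hD : 0 < D c μ σ x y := D_pos hc hμ hx.ne'
  have hρ : 0 < μ / σ := div_pos_of_neg_of_neg hμ hσ
  have hQ : ∀ v ∈ Icc (M₀ a c) 0,
      Q a c μ σ k v x y = lowerQ k a c (-μ) (-σ) (μ / σ) (D c μ σ x y) x v := fun v hv =>
    Q_eq_lowerQ hk (hy.trans hx) hD (add_mul_nonneg_of_M₀_le hc hv.1)
  have hmono := lowerQ_strictMonoOn (k := k) (a := a) (X := x) hc (neg_pos.2 hμ) hρ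
    (div_mul_neg_self hσ.ne) hD.le hx.le
  have hM0 : M₀ a c ≤ 0 := div_nonpos_of_nonpos_of_nonneg (by linarith) hc.le
  obtain ⟨m, hm, hm0⟩ := intermediate_value_Icc hM0
    (continuous_lowerQ k a c (-μ) (-σ) (μ / σ) (D c μ σ x y) x).continuousOn
    ⟨(lowerQ_left_neg ha hc hρ).le, (lowerQ_zero_pos ha (neg_pos.2 hσ) hD hx).le⟩
  refine ⟨m, hm, fun v hv => ?_, by rw [hQ m hm, hm0], fun v hv => ?_⟩
  · have hv' : v ∈ Icc (M₀ a c) 0 := ⟨hv.1, hv.2.le.trans hm.2⟩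
    rw [hQ v hv', ← hm0]
    exact hmono hv' hm hv.2
  · have hv' : v ∈ Icc (M₀ a c) 0 := ⟨hm.1.trans hv.1.le, hv.2⟩
    rw [hQ v hv', ← hm0]
    exact hmono hm hv' hv.1

lemma exists_isUpperZero {k : ℕ} (hk : k = 1 ∨ k = 2) {a c μ σ x y : ℝ} (ha : 0 < a) (hc : 0 < c)
    (hσμ : σ ≤ μ) (hμ : μ < 0) (hxM : M₀ a c ≤ x) (hx : x < 0) (hy : 0 < y) :
    ∃ p, IsUpperZero a c μ σ k x y p := by
  have hσ : σ < 0 := hσμ.trans_lt hμ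
  have hD : 0 < D c μ σ x y := D_pos hc hμ hx.ne
  have hρ : 0 < μ / σ := div_pos_of_neg_of_neg hμ hσ
  have hρ1 : μ / σ ≤ 1 := (div_le_one_of_neg hσ).2 hσμ
  have hB : μ / σ * (-σ) = -μ := div_mul_neg_self hσ.ne
  have hX : 0 < -x := neg_pos.2 hx
  have hXa : c * -x ≤ a := by linarith [add_mul_nonneg_of_M₀_le hc hxM]
  have hDX : (-μ + -σ) * -x ≤ D c μ σ x y := by
    refine le_trans ?_ (abs_mul_le_D hc)
    rw [← abs_of_neg hμ, ← abs_of_neg hσ, ← abs_of_neg hx]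
    gcongr
    exact le_max_left _ _
  have hQ : ∀ v, 0 ≤ v →
      Q a c μ σ k v x y = upperQ k a c (-μ) (-σ) (μ / σ) (D c μ σ x y) (-x) v := fun v hv =>
    Q_eq_upperQ hk (hx.trans hy) hD (by positivity)
  have hcross := crossesUp_upperQ hk ha hc (neg_pos.2 hμ) hρ hρ1 hB hXa hX hD hDX
  have hr : 0 ≤ -x / (μ / σ) := by positivity
  obtain ⟨p, hp, hp0⟩ := intermediate_value_Icc hr
    (continuous_upperQ k a c (-μ) (-σ) (μ / σ) (D c μ σ x y) (-x)).continuousOn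
    ⟨(upperQ_zero_neg ha (neg_pos.2 hσ) hD hX).le,
      (upperQ_pos_of_le ha hc (neg_pos.2 hμ) hρ hB hX
        (by rw [← mul_div_assoc, mul_div_cancel_left₀ _ hρ.ne'])).le⟩
  refine ⟨p, hp.1, fun v hv => ?_, by rw [hQ p hp.1, hp0], fun v hv => ?_⟩
  · rw [hQ v hv.1]
    by_contra! h
    exact (hcross v ⟨hv.1, hv.2.le.trans hp.2⟩ p hp hv.2 h).ne' hp0
  · have hv0 : 0 ≤ v := hp.1.trans (le_of_lt hv)
    rw [hQ v hv0]
    rcases le_total v (-x / (μ / σ)) with h | h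
    · exact hcross p hp v ⟨hv0, h⟩ hv hp0.ge
    · exact upperQ_pos_of_le ha hc (neg_pos.2 hμ) hρ hB hX ((div_le_iff₀' hρ).1 h)

/-- Tightening both bounds lowers the profile strictly, both through `x` and through `D`. -/
lemma Q_lower_lt {k : ℕ} (hk : k = 1 ∨ k = 2) {a c μ σ v x y x' y' : ℝ} (hc : 0 < c) (hμ : μ < 0)
    (hσ : σ < 0) (hx : 0 < x) (hxx : x < x') (hy : y < 0) (hyy : y' < y) (hw : 0 < a + c * v) :
    Q a c μ σ k v x y < Q a c μ σ k v x' y' := by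
  have hDD : D c μ σ x y < D c μ σ x' y' := D_lt_D hc hμ
    (by rwa [abs_of_pos hx, abs_of_pos (hx.trans hxx)])
    (by rw [abs_of_neg hy, abs_of_neg (hyy.trans hy)]; linarith)
  have hD := D_pos (σ := σ) (y := y) hc hμ hx.ne'
  rw [Q_eq_lowerQ hk (by linarith) hD hw.le, Q_eq_lowerQ hk (by linarith) (hD.trans hDD) hw.le]
  have := mul_lt_mul_of_pos_left
    (response_lt (k := k) (A := -μ) (b := -(μ / σ * v)) hxx hDD hw) (neg_pos.2 hσ)
  unfold lowerQ
  linarith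

lemma Q_upper_lt {k : ℕ} (hk : k = 1 ∨ k = 2) {a c μ σ v x y x' y' : ℝ} (hc : 0 < c) (hμ : μ < 0)
    (hσ : σ < 0) (hx : x < 0) (hxx : x' < x) (hy : 0 < y) (hyy : y < y') (hw : 0 < a + c * v) :
    Q a c μ σ k v x' y' < Q a c μ σ k v x y := by
  have hDD : D c μ σ x y < D c μ σ x' y' := D_lt_D hc hμ
    (by rw [abs_of_neg hx, abs_of_neg (hxx.trans hx)]; linarith)
    (by rwa [abs_of_pos hy, abs_of_pos (hy.trans hyy)])
  have hD := D_pos (σ := σ) (y := y) hc hμ hx.ne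
  rw [Q_eq_upperQ hk (by linarith) hD hw.le, Q_eq_upperQ hk (by linarith) (hD.trans hDD) hw.le]
  have := mul_lt_mul_of_pos_left
    (response_lt (k := k) (A := -μ) (b := μ / σ * v) (neg_lt_neg hxx) hDD hw) (neg_pos.2 hσ)
  unfold upperQ
  linarith

/-- What the recursion preserves: the bounds have the right signs, and each of them is strictly
improved by the next step. -/
structure GoodBounds (a c μ σ : ℝ) (k : ℕ) (M N : ℝ) : Prop where
  M₀_le : M₀ a c ≤ M
  neg : M < 0
  pos : 0 < N
  lower : Q a c μ σ k M N M < 0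
  upper : 0 < Q a c μ σ k N M N

lemma goodBounds_zero {k : ℕ} (hk : k = 1 ∨ k = 2) {a c μ σ : ℝ} (ha : 0 < a) (hc : 0 < c)
    (hσμ : σ ≤ μ) (hμ : μ < 0) : GoodBounds a c μ σ k (M₀ a c) (N₀ a c μ σ) := by
  have hσ : σ < 0 := hσμ.trans_lt hμ
  have hρ : 0 < μ / σ := div_pos_of_neg_of_neg hμ hσ
  have hM : M₀ a c < 0 := div_neg_of_neg_of_pos (by linarith) hc
  have hN : 0 < N₀ a c μ σ := div_pos_of_neg_of_neg (by nlinarith) (by nlinarith)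
  refine ⟨le_rfl, hM, hN, ?_, ?_⟩
  · rw [Q_eq_lowerQ hk (hM.trans hN) (D_pos hc hμ hN.ne') (add_mul_nonneg_of_M₀_le hc le_rfl)]
    exact lowerQ_left_neg ha hc hρ
  · rw [Q_eq_upperQ hk (hM.trans hN) (D_pos hc hμ hM.ne) (by positivity)]
    refine upperQ_pos_of_le ha hc (neg_pos.2 hμ) hρ (div_mul_neg_self hσ.ne) (neg_pos.2 hM)
      (le_of_eq ?_)
    have := hμ.ne
    have := hσ.ne
    unfold M₀ N₀
    field_simp

lemma GoodBounds.isLowerZero_calM {k : ℕ} (hk : k = 1 ∨ k = 2) {a c μ σ M N : ℝ} (ha : 0 < a)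
    (hc : 0 < c) (hσμ : σ ≤ μ) (hμ : μ < 0) (h : GoodBounds a c μ σ k M N) :
    IsLowerZero a c μ σ k N M (calM a c μ σ k N M) :=
  Classical.epsilon_spec (exists_isLowerZero hk ha hc hσμ hμ h.pos h.neg)

lemma GoodBounds.isUpperZero_calN {k : ℕ} (hk : k = 1 ∨ k = 2) {a c μ σ M N : ℝ} (ha : 0 < a)
    (hc : 0 < c) (hσμ : σ ≤ μ) (hμ : μ < 0) (h : GoodBounds a c μ σ k M N) :
    IsUpperZero a c μ σ k M N (calN a c μ σ k M N) :=
  Classical.epsilon_spec (exists_isUpperZero hk ha hc hσμ hμ h.M₀_le h.neg h.pos)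

lemma GoodBounds.lt_isLowerZero {k : ℕ} {a c μ σ M N m : ℝ} (h : GoodBounds a c μ σ k M N)
    (hm : IsLowerZero a c μ σ k N M m) : M < m := by
  by_contra! hle
  rcases hle.eq_or_lt with rfl | hlt
  · exact h.lower.ne hm.zero
  · exact (hm.pos M ⟨hlt, h.neg.le⟩).not_gt h.lower

lemma GoodBounds.isUpperZero_lt {k : ℕ} {a c μ σ M N p : ℝ} (h : GoodBounds a c μ σ k M N)
    (hp : IsUpperZero a c μ σ k M N p) : p < N := by
  by_contra! hle
  rcases hle.eq_or_lt with rfl | hlt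
  · exact h.upper.ne' hp.zero
  · exact (hp.neg N ⟨h.pos.le, hlt⟩).not_gt h.upper

lemma GoodBounds.isLowerZero_neg {k : ℕ} (hk : k = 1 ∨ k = 2) {a c μ σ M N m : ℝ} (ha : 0 < a)
    (hc : 0 < c) (hσμ : σ ≤ μ) (hμ : μ < 0) (h : GoodBounds a c μ σ k M N)
    (hm : IsLowerZero a c μ σ k N M m) : m < 0 := by
  refine lt_of_le_of_ne hm.mem.2 ?_
  rintro rfl
  have hD := D_pos (σ := σ) (y := M) hc hμ h.pos.ne'
  have h0 := hm.zero
  rw [Q_eq_lowerQ hk (h.neg.trans h.pos) hD (by simpa using ha.le)] at h0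
  exact (lowerQ_zero_pos ha (by linarith) hD h.pos).ne' h0

lemma GoodBounds.isUpperZero_pos {k : ℕ} (hk : k = 1 ∨ k = 2) {a c μ σ M N p : ℝ} (ha : 0 < a)
    (hc : 0 < c) (hσμ : σ ≤ μ) (hμ : μ < 0) (h : GoodBounds a c μ σ k M N)
    (hp : IsUpperZero a c μ σ k M N p) : 0 < p := by
  refine lt_of_le_of_ne hp.nonneg ?_
  rintro rfl
  have hD := D_pos (σ := σ) (y := N) hc hμ h.neg.ne
  have h0 := hp.zero
  rw [Q_eq_upperQ hk (h.neg.trans h.pos) hD (by simpa using ha.le)] at h0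
  exact (upperQ_zero_neg ha (by linarith) hD (neg_pos.2 h.neg)).ne h0

lemma GoodBounds.next {k : ℕ} (hk : k = 1 ∨ k = 2) {a c μ σ M N m p : ℝ} (ha : 0 < a)
    (hc : 0 < c) (hσμ : σ ≤ μ) (hμ : μ < 0) (h : GoodBounds a c μ σ k M N)
    (hm : IsLowerZero a c μ σ k N M m) (hp : IsUpperZero a c μ σ k M N p) :
    GoodBounds a c μ σ k m p := by
  have hσ : σ < 0 := hσμ.trans_lt hμ
  have hMm := h.lt_isLowerZero hm
  have hpN := h.isUpperZero_lt hp
  have hm0 := h.isLowerZero_neg hk ha hc hσμ hμ hm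
  have hp0 := h.isUpperZero_pos hk ha hc hσμ hμ hp
  refine ⟨h.M₀_le.trans hMm.le, hm0, hp0, ?_, ?_⟩
  · have hw : 0 < a + c * m := by
      have := add_mul_nonneg_of_M₀_le hc h.M₀_le
      have : c * M < c * m := by gcongr
      linarith
    exact (Q_lower_lt hk hc hμ hσ hp0 hpN hm0 hMm hw).trans_eq hm.zero
  · exact hp.zero.symm.trans_lt (Q_upper_lt hk hc hμ hσ hm0 hMm hp0 hpN (by positivity))

lemma goodBounds {k : ℕ} (hk : k = 1 ∨ k = 2) {a c μ σ : ℝ} (ha : 0 < a)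
    (hc : 0 < c) (hσμ : σ ≤ μ) (hμ : μ < 0) (n : ℕ) :
    GoodBounds a c μ σ k (lowerBd a c μ σ k n) (upperBd a c μ σ k n) := by
  induction n with
  | zero => exact goodBounds_zero hk ha hc hσμ hμ
  | succ n ih =>
    exact ih.next hk ha hc hσμ hμ (ih.isLowerZero_calM hk ha hc hσμ hμ)
      (ih.isUpperZero_calN hk ha hc hσμ hμ)

/-! ### Trapping by critical points -/

/-- The value `u (t - a - c * u t)` of the delayed term of the equation at time `t`. -/
def delayed (a c : ℝ) (u : ℝ → ℝ) (t : ℝ) : ℝ := u (t - a - c * u t)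

lemma exists_gt_of_le_deriv {f f' : ℝ → ℝ} {T ε : ℝ} (hε : 0 < ε)
    (hf : ∀ t ≥ T, HasDerivAt f (f' t) t) (hf' : ∀ t ≥ T, ε ≤ f' t) (C : ℝ) :
    ∃ t ≥ T, C < f t := by
  refine ⟨T + (|C - f T| + 1) / ε, ?_, ?_⟩
  · have : 0 ≤ (|C - f T| + 1) / ε := by positivity
    linarith
  have hd : 0 ≤ (|C - f T| + 1) / ε := by positivity
  have h := (convex_Ici T).mul_sub_le_image_sub_of_le_deriv (f := f) (C := ε)
    (fun t ht => (hf t ht).continuousAt.continuousWithinAt)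
    (fun t ht => (hf t (interior_subset ht)).differentiableAt.differentiableWithinAt)
    (fun t ht => by rw [(hf t (interior_subset ht)).deriv]; exact hf' t (interior_subset ht))
    T self_mem_Ici (T + (|C - f T| + 1) / ε) (by simpa using hd) (by linarith)
  have h1 : ε * (T + (|C - f T| + 1) / ε - T) = |C - f T| + 1 := by field_simp; ring
  have := le_abs_self (C - f T)
  linarith

/-- A function that keeps returning above `m` and has no critical point below `m` is eventually
above `m`: an excursion below `m` between two returns would have an interior minimum. -/
lemma eventually_ge_of_no_critical {f f' : ℝ → ℝ} {T m : ℝ}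
    (hf : ∀ t ≥ T, HasDerivAt f (f' t) t) (hcrit : ∀ t ≥ T, f t < m → f' t ≠ 0)
    (hret : ∀ s, ∃ t ≥ s, m ≤ f t) : ∃ T', ∀ t ≥ T', m ≤ f t := by
  obtain ⟨t₀, ht₀, hm₀⟩ := hret T
  refine ⟨t₀, fun t₁ ht₁ => ?_⟩
  by_contra! hlt
  obtain ⟨t₂, ht₂, hm₂⟩ := hret t₁
  have hcont : ContinuousOn f (Icc t₀ t₂) := fun t ht =>
    (hf t (ht₀.le.trans ht.1)).continuousAt.continuousWithinAt
  obtain ⟨r, hr, hmin⟩ := isCompact_Icc.exists_isMinOn ⟨t₁, ht₁, ht₂⟩ hcont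
  have hrm : f r < m := (hmin ⟨ht₁, ht₂⟩).trans_lt hlt
  have hr0 : t₀ < r := lt_of_le_of_ne hr.1 (by rintro rfl; linarith)
  have hr2 : r < t₂ := lt_of_le_of_ne hr.2 (by rintro rfl; linarith)
  have hloc : IsLocalMin f r := hmin.isLocalMin (Icc_mem_nhds hr0 hr2)
  exact hcrit r (ht₀.le.trans hr.1) hrm (hloc.hasDerivAt_eq_zero (hf r (ht₀.le.trans hr.1)))

lemma eventually_le_of_no_critical {f f' : ℝ → ℝ} {T m : ℝ}
    (hf : ∀ t ≥ T, HasDerivAt f (f' t) t) (hcrit : ∀ t ≥ T, m < f t → f' t ≠ 0)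
    (hret : ∀ s, ∃ t ≥ s, f t ≤ m) : ∃ T', ∀ t ≥ T', f t ≤ m := by
  obtain ⟨T', h⟩ := eventually_ge_of_no_critical (f := fun t => -f t) (f' := fun t => -f' t)
    (m := -m) (fun t ht => (hf t ht).neg) (fun t ht h => neg_ne_zero.2 (hcrit t ht (by linarith)))
    (fun s => by obtain ⟨t, ht, h⟩ := hret s; exact ⟨t, ht, by linarith⟩)
  exact ⟨T', fun t ht => by have := h t ht; linarith⟩

section Equation

variable {a c μ σ : ℝ} {u : ℝ → ℝ}

/-- If `u < m < 0` from some time on, then eventually the delayed term is below `m` too, and `u'`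
exceeds the positive number `(μ + σ) * m`. -/
lemma exists_ge_of_neg (ha : 0 < a) (hc : 0 < c) (hσμ : σ ≤ μ) (hμ : μ < 0)
    (hu : ∀ t > 0, HasDerivAt u (μ * u t + σ * delayed a c u t) t) {m : ℝ} (hm : m < 0) (s : ℝ) :
    ∃ t ≥ s, m ≤ u t := by
  by_contra! h
  obtain ⟨t, ht, hlt⟩ := exists_gt_of_le_deriv (T := max s 0 + a) (ε := (μ + σ) * m)
    (by nlinarith) (fun t ht => hu t (by linarith [le_max_right s 0, ht.le]))
    (fun t ht => by
      have h1 : u t < m := h t (by linarith [le_max_left s 0, ht.le])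
      have h2 : delayed a c u t < m :=
        h _ (by nlinarith [le_max_left s 0, ht.le])
      nlinarith) m
  exact hlt.not_gt (h t (by linarith [le_max_left s 0, ht.le]))

/-- The counterpart of `exists_ge_of_neg`. An upper bound `K` is needed to bound the delay. -/
lemma exists_le_of_pos (ha : 0 < a) (hc : 0 < c) (hσμ : σ ≤ μ) (hμ : μ < 0)
    (hu : ∀ t > 0, HasDerivAt u (μ * u t + σ * delayed a c u t) t) {p K T : ℝ} (hp : 0 < p)
    (hK : ∀ t ≥ T, p < u t → u t ≤ K) (s : ℝ) : ∃ t ≥ s, u t ≤ p := by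
  by_contra! h
  have hK0 : 0 ≤ K := by
    have h1 := h (max s T) (le_max_left _ _)
    have h2 := hK (max s T) (le_max_right _ _) h1
    linarith
  have hcK : 0 ≤ c * K := by positivity
  have hT : ∀ t ≥ max s (max T 0) + a + c * K, s + a + c * K ≤ t ∧ T ≤ t ∧ 0 < t ∧ s ≤ t := by
    intro t ht
    have h1 := le_max_left s (max T 0)
    have h2 := (le_max_left T 0).trans (le_max_right s (max T 0))
    have h3 := (le_max_right T 0).trans (le_max_right s (max T 0))
    refine ⟨?_, ?_, ?_, ?_⟩ <;> linarith [ht.le]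
  obtain ⟨t, ht, hlt⟩ := exists_gt_of_le_deriv (f := fun t => -u t)
    (f' := fun t => -(μ * u t + σ * delayed a c u t))
    (T := max s (max T 0) + a + c * K) (ε := -((μ + σ) * p))
    (by nlinarith) (fun t ht => (hu t (hT t ht).2.2.1).neg)
    (fun t ht => by
      obtain ⟨h1, h2, h3, h4⟩ := hT t ht
      have h5 : p < u t := h t h4
      have h7 : c * u t ≤ c * K := by gcongr; exact hK t h2 h5
      have h6 : p < delayed a c u t := h _ (by linarith)
      nlinarith) (-p)
  have := h t (hT t ht).2.2.2
  linarith

/-- While `u` stays in `[M, N]`, its derivative is bounded by `(|μ| + |σ|) * max |N| |M|` one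
maximal delay later. -/
lemma abs_sub_le_of_mem (hc : 0 < c)
    (hu : ∀ t > 0, HasDerivAt u (μ * u t + σ * delayed a c u t) t) {M N T : ℝ} (hT : 0 < T)
    (hK : 0 ≤ a + c * N) (hMN : ∀ t ≥ T, u t ∈ Icc M N) {r s : ℝ} (hr : T + (a + c * N) ≤ r)
    (hs : T + (a + c * N) ≤ s) :
    |u r - u s| ≤ (|μ| + |σ|) * max |N| |M| * |r - s| := by
  have habs : ∀ t ≥ T, |u t| ≤ max |N| |M| := by
    intro t ht
    rw [max_comm]
    exact abs_le_max_abs_abs (hMN t ht).1 (hMN t ht).2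
  refine (convex_Ici (T + (a + c * N))).norm_image_sub_le_of_norm_hasDerivWithin_le
    (f := u) (fun t ht => (hu t ?_).hasDerivWithinAt) (fun t ht => ?_) hs hr
  · have : T + (a + c * N) ≤ t := ht
    linarith
  · have ht' : T + (a + c * N) ≤ t := ht
    have h1 := habs t (by linarith)
    have h2 : |delayed a c u t| ≤ max |N| |M| := by
      refine habs _ ?_
      have : c * u t ≤ c * N := by gcongr; exact (hMN t (by linarith)).2
      linarith
    calc |μ * u t + σ * delayed a c u t| ≤ |μ| * |u t| + |σ| * |delayed a c u t| := by
          rw [← abs_mul, ← abs_mul]; exact abs_add_le _ _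
      _ ≤ |μ| * max |N| |M| + |σ| * max |N| |M| := by gcongr
      _ = _ := by ring

/-- While `u` stays in `[M, N]`, the delayed term is Lipschitz with constant `D`. -/
lemma abs_delayed_sub_le (hc : 0 < c)
    (hu : ∀ t > 0, HasDerivAt u (μ * u t + σ * delayed a c u t) t) {M N T : ℝ} (hT : 0 < T)
    (hK : 0 ≤ a + c * N) (hMN : ∀ t ≥ T, u t ∈ Icc M N) {r s : ℝ}
    (hr : T + 2 * (a + c * N) ≤ r) (hs : T + 2 * (a + c * N) ≤ s) :
    |delayed a c u r - delayed a c u s| ≤ D c μ σ N M * |r - s| := by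
  have harg : ∀ t, T + 2 * (a + c * N) ≤ t → T + (a + c * N) ≤ t - a - c * u t := by
    intro t ht
    have : c * u t ≤ c * N := by gcongr; exact (hMN t (by linarith)).2
    linarith
  have h1 := abs_sub_le_of_mem hc hu hT hK hMN (harg r hr) (harg s hs)
  have h2 := abs_sub_le_of_mem hc hu hT hK hMN (r := r) (s := s) (by linarith) (by linarith)
  have hL : 0 ≤ (|μ| + |σ|) * max |N| |M| := by
    have : 0 ≤ max |N| |M| := (abs_nonneg N).trans (le_max_left _ _)
    positivity
  have h3 : |(r - a - c * u r) - (s - a - c * u s)| ≤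
      |r - s| + c * ((|μ| + |σ|) * max |N| |M| * |r - s|) := by
    calc _ = |(r - s) - c * (u r - u s)| := by ring_nf
      _ ≤ |r - s| + |c * (u r - u s)| := abs_sub _ _
      _ = |r - s| + c * |u r - u s| := by rw [abs_mul, abs_of_pos hc]
      _ ≤ _ := by gcongr
  calc _ ≤ _ := h1
    _ ≤ (|μ| + |σ|) * max |N| |M| *
        (|r - s| + c * ((|μ| + |σ|) * max |N| |M| * |r - s|)) := by gcongr
    _ = _ := by unfold D; ring

lemma continuousAt_delayed
    (hu : ∀ t > 0, HasDerivAt u (μ * u t + σ * delayed a c u t) t) {t : ℝ} (ht : 0 < t)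
    (ht' : 0 < t - a - c * u t) : ContinuousAt (delayed a c u) t := by
  have h1 : ContinuousAt (fun t => t - a - c * u t) t :=
    (continuousAt_id.sub continuousAt_const).sub (continuousAt_const.mul (hu t ht).continuousAt)
  exact ContinuousAt.comp (f := fun t => t - a - c * u t) (g := u) (hu _ ht').continuousAt h1

/-- Variation of constants over the length of the delay. -/
lemma sub_eq_integral_delayed
    (hu : ∀ t > 0, HasDerivAt u (μ * u t + σ * delayed a c u t) t) {t w : ℝ} (hw : 0 ≤ w)
    (ht : ∀ s ∈ Icc 0 w, 0 < t - s) (ht' : ∀ s ∈ Icc 0 w, 0 < t - s - a - c * u (t - s)) :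
    u t - Real.exp (μ * w) * u (t - w) =
      σ * ∫ s in (0 : ℝ)..w, Real.exp (μ * s) * delayed a c u (t - s) := by
  have hd : ∀ s ∈ uIcc 0 w, HasDerivAt (fun s => -(Real.exp (μ * s) * u (t - s)))
      (σ * (Real.exp (μ * s) * delayed a c u (t - s))) s := by
    intro s hs
    rw [uIcc_of_le hw] at hs
    have h1 : HasDerivAt (fun s => Real.exp (μ * s)) (Real.exp (μ * s) * (μ * 1)) s :=
      ((hasDerivAt_id s).const_mul μ).exp
    have h2 : HasDerivAt (fun s => u (t - s))
        ((μ * u (t - s) + σ * delayed a c u (t - s)) * -1) s :=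
      (hu (t - s) (ht s hs)).comp s ((hasDerivAt_id s).const_sub t)
    refine (h1.mul h2).neg.congr_deriv ?_
    ring
  have hcont : ContinuousOn (fun s => σ * (Real.exp (μ * s) * delayed a c u (t - s)))
      (uIcc 0 w) := by
    intro s hs
    rw [uIcc_of_le hw] at hs
    have h1 : ContinuousAt (fun s => delayed a c u (t - s)) s :=
      ContinuousAt.comp (f := fun s => t - s) (continuousAt_delayed hu (ht s hs) (ht' s hs))
        (by fun_prop)
    exact (continuousAt_const.mul ((by fun_prop :
      Continuous fun s => Real.exp (μ * s)).continuousAt.mul h1)).continuousWithinAt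
  have h := intervalIntegral.integral_eq_sub_of_hasDerivAt hd hcont.intervalIntegrable
  rw [intervalIntegral.integral_const_mul] at h
  rw [h]
  simp
  ring

/-- At a critical time `t` that is late enough, the sign of `Q` at `u t` is determined: the delayed
term takes the value `-(μ / σ) * u t` at time `t` itself, so on the preceding interval of length
`a + c * u t` it is dominated by the profile, on both sides. Three
maximal delays are needed: one for the length of the interval, and two for the Lipschitz bound of
the delayed term on it. -/
lemma lowerQ_nonneg_and_upperQ_nonpos {k : ℕ} (hc : 0 < c) (hσ : σ < 0)
    (hu : ∀ t > 0, HasDerivAt u (μ * u t + σ * delayed a c u t) t) {M N T t : ℝ} (hT : 0 < T)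
    (hM : M₀ a c ≤ M) (hMN : ∀ t ≥ T, u t ∈ Icc M N) (ht : T + 3 * (a + c * N) ≤ t)
    (hcrit : μ * u t + σ * delayed a c u t = 0) :
    0 ≤ lowerQ k a c (-μ) (-σ) (μ / σ) (D c μ σ N M) N (u t) ∧
      upperQ k a c (-μ) (-σ) (μ / σ) (D c μ σ N M) (-M) (u t) ≤ 0 := by
  have hNM : M ≤ N := (hMN T le_rfl).1.trans (hMN T le_rfl).2
  have hK : 0 ≤ a + c * N := add_mul_nonneg_of_M₀_le hc (hM.trans hNM)
  have hut := hMN t (by linarith)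
  set w := a + c * u t with hw
  have hw0 : 0 ≤ w := add_mul_nonneg_of_M₀_le hc (hM.trans hut.1)
  have hwK : w ≤ a + c * N := by
    have : c * u t ≤ c * N := by gcongr; exact hut.2
    linarith
  have harg : ∀ s ∈ Icc 0 w, T + 2 * (a + c * N) ≤ t - s := fun s hs => by linarith [hs.2]
  have harg' : ∀ s ∈ Icc 0 w, T ≤ t - s - a - c * u (t - s) := by
    intro s hs
    have h1 := harg s hs
    have : c * u (t - s) ≤ c * N := by gcongr; exact (hMN (t - s) (by linarith)).2
    linarith
  have hd0 : delayed a c u t = -(μ / σ * u t) := by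
    have := hσ.ne
    field_simp
    linarith
  have hut' : u (t - w) = -(μ / σ * u t) := by
    rw [← hd0, delayed, hw]; congr 1; ring
  have hvar := sub_eq_integral_delayed hu hw0 (t := t) (fun s hs => by linarith [harg s hs])
    (fun s hs => hT.trans_le (harg' s hs))
  rw [hut'] at hvar
  have hbd : ∀ s ∈ Icc 0 w, delayed a c u (t - s) ≤ profile k (D c μ σ N M) N (-(μ / σ * u t)) s ∧
      -delayed a c u (t - s) ≤ profile k (D c μ σ N M) (-M) (μ / σ * u t) s := by
    intro s hs
    have h1 : delayed a c u (t - s) ∈ Icc M N := hMN _ (harg' s hs)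
    have h2 := abs_delayed_sub_le hc hu hT hK hMN (harg s hs) (s := t) (by linarith)
    rw [show t - s - t = -s by ring, abs_neg, abs_of_nonneg hs.1, hd0] at h2
    have h3 := abs_le.1 h2
    unfold profile
    split_ifs
    · exact ⟨h1.2, neg_le_neg h1.1⟩
    · exact ⟨le_min h1.2 (by linarith), le_min (neg_le_neg h1.1) (by linarith)⟩
  have hint : IntervalIntegrable (fun s => Real.exp (μ * s) * delayed a c u (t - s))
      MeasureTheory.volume 0 w := by
    refine ContinuousOn.intervalIntegrable fun s hs => ?_
    rw [uIcc_of_le hw0] at hs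
    have h1 : ContinuousAt (fun s => delayed a c u (t - s)) s :=
      ContinuousAt.comp (f := fun s => t - s) (continuousAt_delayed hu (by linarith [harg s hs])
        (hT.trans_le (harg' s hs))) (by fun_prop)
    exact ((by fun_prop : Continuous fun s => Real.exp (μ * s)).continuousAt.mul
      h1).continuousWithinAt
  have hup : (∫ s in (0 : ℝ)..w, Real.exp (μ * s) * delayed a c u (t - s)) ≤
      response k (-μ) (D c μ σ N M) N (-(μ / σ * u t)) w := by
    refine intervalIntegral.integral_mono_on hw0 hint
      ((continuous_integrand k _ _ _ _).intervalIntegrable _ _) fun s hs => ?_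
    rw [neg_neg]
    exact mul_le_mul_of_nonneg_left (hbd s hs).1 (Real.exp_pos _).le
  have hlow : -(∫ s in (0 : ℝ)..w, Real.exp (μ * s) * delayed a c u (t - s)) ≤
      response k (-μ) (D c μ σ N M) (-M) (μ / σ * u t) w := by
    rw [← intervalIntegral.integral_neg]
    refine intervalIntegral.integral_mono_on hw0 hint.neg
      ((continuous_integrand k _ _ _ _).intervalIntegrable _ _) fun s hs => ?_
    rw [neg_neg, ← mul_neg]
    exact mul_le_mul_of_nonneg_left (hbd s hs).2 (Real.exp_pos _).le
  unfold lowerQ upperQ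
  rw [← hw, neg_neg]
  constructor
  · have := mul_le_mul_of_nonpos_left hup hσ.le
    linarith
  · have := mul_le_mul_of_nonpos_left hlow hσ.le
    linarith

/-- One step of the iteration: a solution trapped in `[M, N]` is eventually trapped between the
zeros `m` and `p`. -/
lemma GoodBounds.eventually_mem {k : ℕ} (hk : k = 1 ∨ k = 2) (ha : 0 < a) (hc : 0 < c)
    (hσμ : σ ≤ μ) (hμ : μ < 0)
    (hu : ∀ t > 0, HasDerivAt u (μ * u t + σ * delayed a c u t) t) {M N m p : ℝ}
    (h : GoodBounds a c μ σ k M N) (hm : IsLowerZero a c μ σ k N M m)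
    (hp : IsUpperZero a c μ σ k M N p) (hMN : ∃ T, ∀ t ≥ T, u t ∈ Icc M N) :
    ∃ T, ∀ t ≥ T, u t ∈ Icc m p := by
  obtain ⟨T₀, hT₀⟩ := hMN
  set T := max T₀ 1 with hTdef
  have hT : 0 < T := zero_lt_one.trans_le (le_max_right _ _)
  have hMN : ∀ t ≥ T, u t ∈ Icc M N := fun t ht => hT₀ t ((le_max_left _ _).trans ht)
  have hσ : σ < 0 := hσμ.trans_lt hμ
  have hm0 := h.isLowerZero_neg hk ha hc hσμ hμ hm
  have hp0 := h.isUpperZero_pos hk ha hc hσμ hμ hp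
  have hN := h.pos
  have hcN : 0 < a + c * N := by positivity
  have hlt : M < N := h.neg.trans h.pos
  have hD : 0 < D c μ σ N M := D_pos hc hμ h.pos.ne'
  have hd : ∀ t ≥ T + 3 * (a + c * N), HasDerivAt u (μ * u t + σ * delayed a c u t) t :=
    fun t ht => hu t (by linarith [ht.le])
  have hQ := fun (t : ℝ) (ht : t ≥ T + 3 * (a + c * N)) =>
    lowerQ_nonneg_and_upperQ_nonpos (k := k) hc hσ hu hT h.M₀_le hMN ht
  have hmem : ∀ t ≥ T + 3 * (a + c * N), u t ∈ Icc M N := fun t ht =>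
    hMN t (by linarith [ht.le])
  have hw : ∀ t ≥ T + 3 * (a + c * N), 0 ≤ a + c * u t := fun t ht =>
    add_mul_nonneg_of_M₀_le hc (h.M₀_le.trans (hmem t ht).1)
  obtain ⟨T₁, hT₁⟩ := eventually_ge_of_no_critical hd (m := m) (fun t ht hut hcrit => by
    have h1 := (hQ t ht hcrit).1
    rw [← Q_eq_lowerQ hk hlt hD (hw t ht)] at h1
    exact h1.not_gt (hm.neg _ ⟨h.M₀_le.trans (hmem t ht).1, hut⟩))
    (exists_ge_of_neg ha hc hσμ hμ hu hm0)
  obtain ⟨T₂, hT₂⟩ := eventually_le_of_no_critical hd (m := p) (fun t ht hut hcrit => by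
    have h1 := (hQ t ht hcrit).2
    rw [D_comm, ← Q_eq_upperQ hk hlt (by rwa [D_comm]) (hw t ht)] at h1
    exact h1.not_gt (hp.pos _ hut))
    (exists_le_of_pos ha hc hσμ hμ hu hp0 fun t ht _ => (hMN t ht).2)
  exact ⟨max T₁ T₂, fun t ht => ⟨hT₁ t ((le_max_left _ _).trans ht),
    hT₂ t ((le_max_right _ _).trans ht)⟩⟩

end Equation

/-! ### A priori bounds -/

section APriori

variable {a c μ σ : ℝ} {φ u : ℝ → ℝ}

lemma N₀_pos (ha : 0 < a) (hc : 0 < c) (hσ : σ < 0) (hμ : μ < 0) : 0 < N₀ a c μ σ :=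
  div_pos_of_neg_of_neg (mul_neg_of_pos_of_neg ha hσ) (mul_neg_of_pos_of_neg hc hμ)

lemma delayBound_pos (ha : 0 < a) (hc : 0 < c) (hσ : σ < 0) (hμ : μ < 0) :
    0 < delayBound a c μ σ φ := by
  have h : 0 < upperN a c μ σ φ := (N₀_pos ha hc hσ hμ).trans_le (le_max_right _ _)
  unfold delayBound
  positivity

lemma IsSolution.continuousOn_Ici {τ : ℝ} (hu : IsSolution a c μ σ τ φ u) (hτ : 0 ≤ τ)
    (hφ : ContinuousOn φ (Icc (-τ) 0)) : ContinuousOn u (Ici (-τ)) := by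
  have h1 : ContinuousOn u (Icc (-τ) 0) := hφ.congr hu.history
  have h2 := h1.union_of_isClosed hu.continuousOn isClosed_Icc isClosed_Ici
  rwa [Icc_union_Ici_eq_Ici (by linarith)] at h2

/-- The deviating argument stays in the domain of the solution at time `0` too. -/
lemma IsSolution.neg_delayBound_le (ha : 0 < a) (hc : 0 < c) (hσ : σ < 0) (hμ : μ < 0)
    (hu : IsSolution a c μ σ (delayBound a c μ σ φ) φ u) {t : ℝ} (ht : 0 ≤ t) :
    -delayBound a c μ σ φ ≤ t - a - c * u t := by
  rcases ht.eq_or_lt with rfl | ht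
  · have hτ := delayBound_pos (φ := φ) ha hc hσ hμ
    rw [hu.history 0 ⟨by linarith, le_rfl⟩]
    have : c * φ 0 ≤ c * upperN a c μ σ φ := by gcongr; exact le_max_left _ _
    unfold delayBound
    linarith
  · exact hu.mem_domain t ht

/-- The equation holds at time `0` as well, for the right derivative. -/
lemma IsSolution.hasDerivWithinAt_Ici (ha : 0 < a) (hc : 0 < c) (hσ : σ < 0) (hμ : μ < 0)
    (hφ : ContinuousOn φ (Icc (-delayBound a c μ σ φ) 0))
    (hu : IsSolution a c μ σ (delayBound a c μ σ φ) φ u) {t : ℝ} (ht : 0 ≤ t) :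
    HasDerivWithinAt u (μ * u t + σ * delayed a c u t) (Ici t) t := by
  rcases ht.eq_or_lt with rfl | ht
  · have hc1 : ContinuousOn (fun t => t - a - c * u t) (Ici 0) :=
      (continuousOn_id.sub continuousOn_const).sub (continuousOn_const.mul hu.continuousOn)
    have hc2 : ContinuousOn (delayed a c u) (Ici 0) :=
      (hu.continuousOn_Ici (delayBound_pos ha hc hσ hμ).le hφ).comp hc1
        fun t ht => hu.neg_delayBound_le ha hc hσ hμ ht
    have hc3 : ContinuousOn (fun t => μ * u t + σ * delayed a c u t) (Ici 0) :=
      (continuousOn_const.mul hu.continuousOn).add (continuousOn_const.mul hc2)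
    refine hasDerivWithinAt_Ici_of_tendsto_deriv (s := Ioi 0)
      (fun t ht => (hu.hasDerivAt t ht).differentiableAt.differentiableWithinAt)
      ((hu.continuousOn 0 self_mem_Ici).mono Ioi_subset_Ici_self) self_mem_nhdsWithin ?_
    refine ((hc3 0 self_mem_Ici).mono Ioi_subset_Ici_self).tendsto.congr' ?_
    filter_upwards [self_mem_nhdsWithin] with t ht
    exact (hu.hasDerivAt t ht).deriv.symm
  · exact (hu.hasDerivAt t ht).hasDerivWithinAt

/-- Where `u = M₀`, the delay vanishes and the equation gives `u' = (μ + σ) * M₀ > 0`. -/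
lemma IsSolution.M₀_le (ha : 0 < a) (hc : 0 < c) (hσ : σ < 0) (hμ : μ < 0)
    (hφ : ContinuousOn φ (Icc (-delayBound a c μ σ φ) 0))
    (hφM : ∀ t ∈ Icc (-delayBound a c μ σ φ) 0, M₀ a c ≤ φ t)
    (hu : IsSolution a c μ σ (delayBound a c μ σ φ) φ u) {t : ℝ}
    (ht : -delayBound a c μ σ φ ≤ t) : M₀ a c ≤ u t := by
  have hτ := delayBound_pos (φ := φ) ha hc hσ hμ
  have hpast : ∀ s ∈ Icc (-delayBound a c μ σ φ) 0, M₀ a c ≤ u s := fun s hs => by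
    rw [hu.history s hs]; exact hφM s hs
  rcases le_total t 0 with h0 | h0
  · exact hpast t ⟨ht, h0⟩
  have h := image_le_of_deriv_right_lt_deriv_boundary' (f := fun s => -u s)
    (f' := fun s => -(μ * u s + σ * delayed a c u s)) (a := 0) (b := t)
    (B := fun _ => -M₀ a c) (B' := fun _ => (0 : ℝ))
    (hu.continuousOn.mono Icc_subset_Ici_self).neg
    (fun s hs => (hu.hasDerivWithinAt_Ici ha hc hσ hμ hφ hs.1).neg)
    (neg_le_neg (hpast 0 ⟨by linarith, le_rfl⟩)) continuousOn_const
    (fun s _ => hasDerivWithinAt_const _ _ _)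
    (fun s _ hs => by
      have hus : u s = M₀ a c := neg_injective hs
      have hM : M₀ a c < 0 := div_neg_of_neg_of_pos (by linarith) hc
      have harg : s - a - c * M₀ a c = s := by unfold M₀; field_simp; ring
      rw [delayed, hus, harg, hus]
      nlinarith) (right_mem_Icc.2 h0)
  linarith

/-- Since the delayed term is at least `M₀`, above `N₀` the solution decreases, so that it has no
critical point there. -/
lemma IsSolution.eventually_mem_M₀_N₀ (ha : 0 < a) (hc : 0 < c) (hσμ : σ ≤ μ) (hμ : μ < 0)
    (hφ : ContinuousOn φ (Icc (-delayBound a c μ σ φ) 0))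
    (hφM : ∀ t ∈ Icc (-delayBound a c μ σ φ) 0, M₀ a c ≤ φ t)
    (hu : IsSolution a c μ σ (delayBound a c μ σ φ) φ u) :
    ∃ T, ∀ t ≥ T, u t ∈ Icc (M₀ a c) (N₀ a c μ σ) := by
  have hσ : σ < 0 := hσμ.trans_lt hμ
  have hN := N₀_pos ha hc hσ hμ
  have hτ := delayBound_pos (φ := φ) ha hc hσ hμ
  have hd : ∀ t > 0, HasDerivAt u (μ * u t + σ * delayed a c u t) t := hu.hasDerivAt
  have hdec : ∀ t > 0, N₀ a c μ σ < u t → μ * u t + σ * delayed a c u t < 0 := by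
    intro t ht hut
    have h1 : M₀ a c ≤ delayed a c u t :=
      hu.M₀_le ha hc hσ hμ hφ hφM (hu.neg_delayBound_le ha hc hσ hμ (le_of_lt ht))
    have h2 : μ * N₀ a c μ σ + σ * M₀ a c = 0 := by
      have := hμ.ne
      unfold M₀ N₀
      field_simp
      ring
    nlinarith
  have hret : ∀ s, ∃ t ≥ s, u t ≤ N₀ a c μ σ := by
    intro s
    by_contra! h
    have hpos : ∀ t ∈ Ici (max s 1), 0 < t := fun t ht =>
      zero_lt_one.trans_le ((le_max_right s 1).trans ht)
    have hanti : AntitoneOn u (Ici (max s 1)) := by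
      refine antitoneOn_of_deriv_nonpos (convex_Ici _)
        (fun t ht => (hd t (hpos t ht)).continuousAt.continuousWithinAt)
        (fun t ht => (hd t (hpos t (interior_subset ht))).differentiableAt.differentiableWithinAt)
        fun t ht => ?_
      have ht' := interior_subset ht
      rw [(hd t (hpos t ht')).deriv]
      exact (hdec t (hpos t ht') (h t ((le_max_left s 1).trans ht'))).le
    obtain ⟨t, ht, hle⟩ := exists_le_of_pos ha hc hσμ hμ hd hN (T := max s 1)
      (fun t ht _ => hanti self_mem_Ici ht ht) s
    exact (h t ht).not_ge hle
  obtain ⟨T, hT⟩ := eventually_le_of_no_critical (T := 1) (fun t ht => hd t (by linarith [ht.le]))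
    (fun t ht hut => (hdec t (by linarith [ht.le]) hut).ne) hret
  exact ⟨max T 0, fun t ht => ⟨hu.M₀_le ha hc hσ hμ hφ hφM
    (by linarith [le_max_right T 0, ht.le]), hT t ((le_max_left _ _).trans ht)⟩⟩

lemma IsSolution.eventually_mem_bounds {k : ℕ} (hk : k = 1 ∨ k = 2) (ha : 0 < a) (hc : 0 < c)
    (hσμ : σ ≤ μ) (hμ : μ < 0)
    (hφ : ContinuousOn φ (Icc (-delayBound a c μ σ φ) 0))
    (hφM : ∀ t ∈ Icc (-delayBound a c μ σ φ) 0, M₀ a c ≤ φ t)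
    (hu : IsSolution a c μ σ (delayBound a c μ σ φ) φ u) (n : ℕ) :
    ∃ T, ∀ t ≥ T, u t ∈ Icc (lowerBd a c μ σ k n) (upperBd a c μ σ k n) := by
  induction n with
  | zero => exact hu.eventually_mem_M₀_N₀ ha hc hσμ hμ hφ hφM
  | succ n ih =>
    have h := goodBounds hk ha hc hσμ hμ n
    exact h.eventually_mem hk ha hc hσμ hμ hu.hasDerivAt (h.isLowerZero_calM hk ha hc hσμ hμ)
      (h.isUpperZero_calN hk ha hc hσμ hμ) ih

end APriori

end

end Sawtooth

theorem mainTheorem1 (k : ℕ) (hk : k = 1 ∨ k = 2) (a c μ σ : ℝ) (ha : 0 < a) (hc : 0 < c)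
    (hσμ : σ ≤ μ) (hμ : μ < 0) :
    -- the sequences are well defined: each new bound is the zero of the relevant function,
    -- and the intervals are strictly nested
    (∀ n : ℕ,
      Sawtooth.IsLowerZero a c μ σ k (Sawtooth.upperBd a c μ σ k n)
        (Sawtooth.lowerBd a c μ σ k n) (Sawtooth.lowerBd a c μ σ k (n + 1)) ∧
      Sawtooth.IsUpperZero a c μ σ k (Sawtooth.lowerBd a c μ σ k n)
        (Sawtooth.upperBd a c μ σ k n) (Sawtooth.upperBd a c μ σ k (n + 1)) ∧
      Sawtooth.lowerBd a c μ σ k n < Sawtooth.lowerBd a c μ σ k (n + 1) ∧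
      Sawtooth.lowerBd a c μ σ k (n + 1) < 0 ∧
      0 < Sawtooth.upperBd a c μ σ k (n + 1) ∧
      Sawtooth.upperBd a c μ σ k (n + 1) < Sawtooth.upperBd a c μ σ k n) ∧
    -- every solution is eventually trapped in each of the intervals
    (∀ φ u : ℝ → ℝ,
      ContinuousOn φ (Set.Icc (-Sawtooth.delayBound a c μ σ φ) 0) →
      (∀ t ∈ Set.Icc (-Sawtooth.delayBound a c μ σ φ) 0, Sawtooth.M₀ a c ≤ φ t) →
      Sawtooth.IsSolution a c μ σ (Sawtooth.delayBound a c μ σ φ) φ u →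
      (∃ T : ℕ → ℝ, Filter.Tendsto T Filter.atTop Filter.atTop ∧
        ∀ n : ℕ, ∀ t : ℝ, T n ≤ t →
          u t ∈ Set.Icc (Sawtooth.lowerBd a c μ σ k n) (Sawtooth.upperBd a c μ σ k n)) ∧
      (∀ p : ℝ, MapClusterPt p Filter.atTop u →
        ∀ n : ℕ, p ∈ Set.Icc (Sawtooth.lowerBd a c μ σ k n) (Sawtooth.upperBd a c μ σ k n))) := by
  refine ⟨fun n => ?_, fun φ u hφ hφM hu => ?_⟩
  · have h := Sawtooth.goodBounds hk ha hc hσμ hμ n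
    have hm := h.isLowerZero_calM hk ha hc hσμ hμ
    have hp := h.isUpperZero_calN hk ha hc hσμ hμ
    exact ⟨hm, hp, h.lt_isLowerZero hm, h.isLowerZero_neg hk ha hc hσμ hμ hm,
      h.isUpperZero_pos hk ha hc hσμ hμ hp, h.isUpperZero_lt hp⟩
  · choose T hT using hu.eventually_mem_bounds hk ha hc hσμ hμ hφ hφM
    refine ⟨⟨fun n => max (T n) n, ?_, fun n t ht => hT n t ((le_max_left _ _).trans ht)⟩,
      fun p hp n => ?_⟩
    · exact Filter.tendsto_atTop_mono (fun n => le_max_right _ _) tendsto_natCast_atTop_atTop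
    · have hev : ∀ᶠ t in Filter.atTop, u t ∈ Set.Icc (Sawtooth.lowerBd a c μ σ k n)
          (Sawtooth.upperBd a c μ σ k n) := Filter.eventually_atTop.2 ⟨T n, hT n⟩
      have hcl := mem_closure_iff_clusterPt.2 (ClusterPt.mono hp (Filter.tendsto_principal.2 hev))
      rwa [isClosed_Icc.closure_eq] at hcl
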